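/- Let $R$ be a commutative ring, $q\in R$, and $n\ge 0$. **Colored free quasi-symmetric functions.** Let $A=\{a_0<a_1<\cdots\}$ be an infinite ordered alphabet. Colored words of length $m$ with $n$ colors are pairs $(w,u)$ with $w\in A^m$ and $u\in\{1,\dots,n\}^m$; they are multiplied by concatenating both components. For a permutation $\tau\in\mathfrak S_m$ and a color word $u$ of length $m$, let $$\mathbf G_{\tau,u}=\sum_{\mathrm{std}(w)=\tau}(w,u),$$ where $\mathrm{std}$ denotes standardization (equal letters being numbered from left to right). These formal series generate (indeed span) the $R$-algebra $\mathbf{FQSym}^{(n)}$ inside the algebra of noncommutative formal series over the colored alphabet. **The elements $\boldsymbol\Psi^\sigma$.** For a color word $u=u_1\cdots u_p$ ($p\geq 1$), let $\Psi^u\in\mathbf{FQSym}^{(n)}$ be obtained from the nested bracket $$\Big[\cdots\big[\tbinom{u_1}{1},\tbinom{u_2}{2}\big]_q\cdots,\tbinom{u_p}{p}\Big]_q,\qquad [x,y]_q=xy-q\,yx,$$ by expanding it as a linear combination of words in the biletters $\binom{u_i}{i}$ (the product being concatenation) and replacing each resulting biword with top row $v$ and bottom row $\tau$ by $\mathbf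 G_{\tau,v}$. A nonempty word $u_1\cdots u_p$ is *initially dominated* if $u_1>u_i$ for all $i>1$. A permutation $\sigma\in\mathfrak S_n$, regarded as the word $\sigma(1)\cdots\sigma(n)$, factors uniquely as $\sigma=u^{(1)}\cdots u^{(p)}$ with all $u^{(i)}$ initially dominated and with weakly increasing first letters; set $$\boldsymbol\Psi^\sigma=\Psi^{u^{(1)}}\cdots\Psi^{u^{(p)}}\in\mathbf{FQSym}^{(n)}$$ (the empty product $1$ if $n=0$), and let $S(\sigma)=(|u^{(1)}|,\dots,|u^{(p)}|)$, a composition of $n$. **Colored ribbons.** For $\tau\in\mathfrak S_n$ let $D(\tau)$ be the composition of $n$ formed by the lengths of the maximal increasing factors of the word $\tau$. For compositions $I,J$ of $n$ set $$R_I^{(J)}=\sum_{\substack{\tau\in\mathfrak S_n,\ D(\tau)=I\\ \sigma\in\mathfrak S_n,\ S(\sigma)=J}}\mathbf G_{\tau,\sigma},$$ where in $\mathbf G_{\tau,\sigma}$ the permutation $\sigma$ is read as a color word. For $I=(i_1,\dots,i_s)$ put $\operatorname{Des}(I)=\{i_1,\,i_1+i_2,\,\dots,\,i_1+\cdots+i_{s-1}\}$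 and $\operatorname{Des}(I)^-=\{d-1: d\in\operatorname{Des}(I)\}$. **Claim.** In $\mathbf{FQSym}^{(n)}$, $$\sum_{\sigma\in\mathfrak S_n}\boldsymbol\Psi^\sigma=\sum_{I,J\,\vDash\, n}c_{IJ}(q)\,R_I^{(J)},$$ where $$c_{IJ}(q)=\begin{cases}0&\text{if }\operatorname{Des}(I)\setminus\operatorname{Des}(I)^-\not\subseteq\operatorname{Des}(J),\\[2pt](-q)^{|\operatorname{Des}(I)\setminus\operatorname{Des}(J)|}\,(1-q)^{|\operatorname{Des}(I)\cap\operatorname{Des}(J)|}&\text{otherwise.}\end{cases}$$ -/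

import Mathlib

/-! ### Noncommutative formal series -/

/-- Noncommutative formal series over an alphabet `X` with coefficients in `R`:
a series is the function sending a word to its coefficient. -/
def WordSeries (R X : Type*) : Type _ := List X → R

namespace WordSeries

variable {R X : Type*} [CommRing R]

instance : AddCommGroup (WordSeries R X) := inferInstanceAs (AddCommGroup (List X → R))

instance : Module R (WordSeries R X) := inferInstanceAs (Module R (List X → R))

/-- The concatenation product: `(f g)(w)` is the sum of `f(u) g(v)` over all factorizations
`w = u v`. -/
instance : Mul (WordSeries R X) :=
  ⟨fun f g w => ∑ i ∈ Finset.range (w.length + 1), f (w.take i) * g (w.drop i)⟩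

/-- The series consisting of the empty word only. -/
instance : One (WordSeries R X) := ⟨fun w => match w with
    | [] => 1
    | _ :: _ => 0⟩

/-- The series whose coefficient at `v` is the coefficient of `f` at `x v`. -/
def shift (f : WordSeries R X) (x : X) : WordSeries R X := fun v => f (x :: v)

theorem add_apply (f g : WordSeries R X) (w : List X) : (f + g) w = f w + g w := rfl

theorem zero_apply (w : List X) : (0 : WordSeries R X) w = 0 := rfl

theorem smul_apply (c : R) (f : WordSeries R X) (w : List X) : (c • f) w = c * f w := rfl

theorem one_nil : (1 : WordSeries R X) [] = 1 := rfl

theorem one_cons (x : X) (w : List X) : (1 : WordSeries R X) (x :: w) = 0 := rfl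

theorem mul_apply (f g : WordSeries R X) (w : List X) :
    (f * g) w = ∑ i ∈ Finset.range (w.length + 1), f (w.take i) * g (w.drop i) := rfl

theorem mul_nil (f g : WordSeries R X) : (f * g) [] = f [] * g [] := by
  simp [mul_apply]

theorem mul_cons (f g : WordSeries R X) (x : X) (w : List X) :
    (f * g) (x :: w) = (f.shift x * g) w + f [] * g (x :: w) := by
  simp [mul_apply, shift, Finset.sum_range_succ' _ (w.length + 1)]

theorem left_distrib' (f g h : WordSeries R X) : f * (g + h) = f * g + f * h := by
  funext w; simp [mul_apply, add_apply, mul_add, Finset.sum_add_distrib]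

theorem right_distrib' (f g h : WordSeries R X) : (f + g) * h = f * h + g * h := by
  funext w; simp [mul_apply, add_apply, add_mul, Finset.sum_add_distrib]

theorem smul_mul' (c : R) (f g : WordSeries R X) : (c • f) * g = c • (f * g) := by
  funext w; simp [mul_apply, smul_apply, mul_assoc, Finset.mul_sum]

theorem mul_smul' (c : R) (f g : WordSeries R X) : f * (c • g) = c • (f * g) := by
  funext w; simp [mul_apply, smul_apply, mul_left_comm, Finset.mul_sum]

theorem mul_assoc' (f g h : WordSeries R X) : f * g * h = f * (g * h) := by
  funext w
  induction w generalizing f with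
  | nil => simp [mul_nil, mul_assoc]
  | cons x w ih =>
    have e : (f * g).shift x = f.shift x * g + f [] • g.shift x := by
      funext v; exact mul_cons f g x v
    rw [mul_cons (f * g), e, right_distrib', smul_mul', add_apply, ih, smul_apply,
      mul_cons f (g * h), mul_cons g h, mul_nil]
    ring

theorem one_mul' (f : WordSeries R X) : 1 * f = f := by
  funext w
  cases w with
  | nil => simp [mul_nil, one_nil]
  | cons x w =>
    have e : (1 : WordSeries R X).shift x = (0 : R) • 1 := by
      funext v
      rw [smul_apply, zero_mul]
      rfl
    rw [mul_cons, e, smul_mul', smul_apply, one_nil]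
    simp

theorem mul_one' (f : WordSeries R X) : f * 1 = f := by
  funext w
  induction w generalizing f with
  | nil => simp [mul_nil, one_nil]
  | cons x w ih => rw [mul_cons, ih, one_cons]; simp [shift]

instance : Ring (WordSeries R X) :=
  { (inferInstance : AddCommGroup (WordSeries R X)) with
    mul := (· * ·)
    one := 1
    left_distrib := left_distrib'
    right_distrib := right_distrib'
    zero_mul := fun f => by funext w; simp [mul_apply, zero_apply]
    mul_zero := fun f => by funext w; simp [mul_apply, zero_apply]
    mul_assoc := mul_assoc'
    one_mul := one_mul'
    mul_one := mul_one' }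

instance : Algebra R (WordSeries R X) := Algebra.ofModule smul_mul' mul_smul'

end WordSeries

/-! ### Colored free quasi-symmetric functions -/

/-- Standardization of a word: its `i`-th letter is replaced by the rank of position `i` when the
positions are sorted by letter, equal letters being numbered from left to right.
The ranks start at `1`. -/
def standardization (w : List ℕ) : List ℕ :=
  List.ofFn fun i : Fin w.length =>
    (Finset.univ.filter fun j : Fin w.length =>
      w.get j < w.get i ∨ (w.get j = w.get i ∧ j ≤ i)).card

/-- The one-line notation `σ(1) … σ(n)` of a permutation, as a word in `1, …, n`. -/
def permWord {n : ℕ} (σ : Equiv.Perm (Fin n)) : List ℕ :=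
  List.ofFn fun i => (σ i : ℕ) + 1

/-- The permutation `σ` as a color word, the colors `1, …, n` being the elements of `Fin n`. -/
def permColorWord {n : ℕ} (σ : Equiv.Perm (Fin n)) : List (Fin n) :=
  List.ofFn fun i => σ i

/-- The series `G_{τ,u}`: the sum of all colored words `(w, u)` with `std(w) = τ`, where `w` runs
over the words in the infinite ordered alphabet `ℕ` and the letter `a_i` of color `c` is `(i, c)`.
(If `τ` is not the one-line notation of a permutation, or if `τ` and `u` have different
lengths, this sum is empty.) -/
def gSeries (R : Type*) [CommRing R] {r : ℕ} (τ : List ℕ) (u : List (Fin r)) :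
    WordSeries R (ℕ × Fin r) := fun w =>
  if standardization (w.map Prod.fst) = τ ∧ w.map Prod.snd = u then 1 else 0

/-- The algebra of free quasi-symmetric functions of level `r` (with `r` colors). -/
def FQSym (R : Type*) [CommRing R] (r : ℕ) : Subalgebra R (WordSeries R (ℕ × Fin r)) :=
  Algebra.adjoin R (Set.range fun p : List ℕ × List (Fin r) => gSeries R p.1 p.2)

/-- `G_{τ,u}` as an element of the algebra of free quasi-symmetric functions of level `r`,
also written as a biword with top row `u` and bottom row `τ`. -/
def biwordG (R : Type*) [CommRing R] {r : ℕ} (τ : List ℕ) (u : List (Fin r)) : FQSym R r :=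
  ⟨gSeries R τ u, Algebra.subset_adjoin ⟨(τ, u), rfl⟩⟩

/-! ### The nested `q`-brackets -/

/-- `[x, y]_q = x y - q y x`. -/
def qBracket {R A : Type*} [CommRing R] [Ring A] [Algebra R A] (q : R) (x y : A) : A :=
  x * y - q • (y * x)

/-- The biletter with top `b.1` (a color) and bottom `b.2` (a positive integer), in the free
associative algebra on biletters (multiplication is concatenation). -/
noncomputable def biletter (R : Type*) [CommRing R] {r : ℕ} (b : Fin r × ℕ) :
    MonoidAlgebra R (FreeMonoid (Fin r × ℕ)) :=
  MonoidAlgebra.of R _ (FreeMonoid.of b)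

/-- The nested bracket `[…[[b₁, b₂]_q, b₃]_q …, b_p]_q` of a list of biletters (`1` if the list
is empty). -/
noncomputable def nestedBracket {R : Type*} [CommRing R] {r : ℕ} (q : R) :
    List (Fin r × ℕ) → MonoidAlgebra R (FreeMonoid (Fin r × ℕ))
  | [] => 1
  | b :: bs => bs.foldl (fun x c => qBracket q x (biletter R c)) (biletter R b)

/-- Interpretation of linear combinations of biwords as elements of `FQSym R r`: the biword with
top row `u` and bottom row `τ` is `G_{τ,u}`. -/
noncomputable def interpretBiwords (R : Type*) [CommRing R] (r : ℕ) :
    MonoidAlgebra R (FreeMonoid (Fin r × ℕ)) →ₗ[R] FQSym R r :=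
  (Finsupp.linearCombination R fun b : FreeMonoid (Fin r × ℕ) =>
      biwordG R (b.toList.map Prod.snd) (b.toList.map Prod.fst)) ∘ₗ
    (MonoidAlgebra.coeffLinearEquiv R).toLinearMap

/-- `Ψ^u` for a color word `u = u₁ … u_p`: the nested `q`-bracket of the biletters
`(u₁, 1), …, (u_p, p)`. -/
noncomputable def Psi {R : Type*} [CommRing R] {r : ℕ} (q : R) (u : List (Fin r)) : FQSym R r :=
  interpretBiwords R r (nestedBracket q (u.zipIdx 1))

/-- The increasing factorization of a word into initially dominated words. -/
def increasingFactorization {α : Type*} [LinearOrder α] : List α → List (List α)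
  | [] => []
  | a :: l => (a :: l.takeWhile (fun b => decide (b < a))) ::
      increasingFactorization (l.dropWhile (fun b => decide (b < a)))
  termination_by l => l.length
  decreasing_by
    exact Nat.lt_succ_of_le (List.dropWhile_suffix _).length_le

/-- A word `u₁ … u_p` with `p ≥ 1` is initially dominated if `u₁ > u_i` for all `i > 1`. -/
def InitiallyDominated {α : Type*} [LinearOrder α] : List α → Prop
  | [] => False
  | a :: l => ∀ b ∈ l, b < a

/-- `increasingFactorization l` is the unique factorization of `l` into initially dominated words
with weakly increasing first letters. -/
theorem increasingFactorization_eq_iff {α : Type*} [LinearOrder α] (l : List α)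
    (L : List (List α)) :
    increasingFactorization l = L ↔
      L.flatten = l ∧ (∀ u ∈ L, InitiallyDominated u) ∧
        L.IsChain (fun u v => ∀ a ∈ u.head?, ∀ b ∈ v.head?, a ≤ b) := by
  constructor
  · rintro rfl
    induction l using increasingFactorization.induct with
    | case1 => simp [increasingFactorization]
    | case2 a l ih =>
      rw [increasingFactorization]
      refine ⟨?_, ?_, ?_⟩
      · simp [ih.1, List.takeWhile_append_dropWhile]
      · intro u hu
        rcases List.mem_cons.1 hu with rfl | hu
        · intro b hb
          simpa using List.mem_takeWhile_imp hb
        · exact ih.2.1 u hu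
      · rw [List.isChain_cons]
        refine ⟨?_, ih.2.2⟩
        intro v hv c hc b hb
        have hca : c = a := by simpa using hc.symm
        subst hca
        cases hd : l.dropWhile (fun b => decide (b < c)) with
        | nil => rw [hd, increasingFactorization] at hv; simp at hv
        | cons d m =>
          rw [hd, increasingFactorization] at hv
          have hv' : d :: m.takeWhile (fun b => decide (b < d)) = v := by simpa using hv
          subst hv'
          have hbd : d = b := by simpa using hb
          subst hbd
          have := List.head?_dropWhile_not (fun b => decide (b < c)) l
          rw [hd] at this
          simpa using this
  · rintro ⟨rfl, hdom, hch⟩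
    induction L with
    | nil => simp [increasingFactorization]
    | cons u L ih =>
      rw [List.isChain_cons] at hch
      have ih' := ih (fun v hv => hdom v (List.mem_cons_of_mem _ hv)) hch.2
      have hu : InitiallyDominated u := hdom u List.mem_cons_self
      cases u with
      | nil => exact hu.elim
      | cons a t =>
        have ht : ∀ b ∈ t, b < a := hu
        have hall : ∀ b ∈ t, (fun b => decide (b < a)) b = true := by simpa using ht
        have hL : L.flatten.takeWhile (fun b => decide (b < a)) = [] ∧
            L.flatten.dropWhile (fun b => decide (b < a)) = L.flatten := by
          cases L with
          | nil => simp
          | cons v L =>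
            have hv : InitiallyDominated v := hdom v (by simp)
            cases v with
            | nil => exact hv.elim
            | cons d m =>
              have : a ≤ d := hch.1 (d :: m) (by simp) a (by simp) d (by simp)
              simp [this]
        rw [List.flatten_cons, List.cons_append, increasingFactorization,
          List.takeWhile_append_of_pos hall, List.dropWhile_append_of_pos hall, hL.1, hL.2, ih',
          List.append_nil]

/-- `Ψ^σ`: the product, in order, of the `Ψ^{u^{(i)}}` over the increasing factorization
`σ = u^{(1)} ⋯ u^{(p)}` of `σ` into initially dominated words. -/
noncomputable def PsiPerm {R : Type*} [CommRing R] {n : ℕ} (q : R) (σ : Equiv.Perm (Fin n)) :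
    FQSym R n :=
  ((increasingFactorization (permColorWord σ)).map (Psi q)).prod

/-! ### Compositions attached to permutations -/

/-- The sizes of the factors of a factorization into nonempty words, as a composition. -/
def sizesComposition {α : Type*} {n : ℕ} (L : List (List α)) (hL : [] ∉ L)
    (hn : L.flatten.length = n) : Composition n where
  blocks := L.map List.length
  blocks_pos := by
    intro i hi
    obtain ⟨u, hu, rfl⟩ := List.mem_map.1 hi
    exact List.length_pos_iff.2 fun h => hL (h ▸ hu)
  blocks_sum := by rw [← List.length_flatten, hn]

/-- The saillance composition `S(σ)`: the sizes of the factors of `σ` into initially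
dominated words. -/
def saillanceComposition {n : ℕ} (σ : Equiv.Perm (Fin n)) : Composition n :=
  sizesComposition (increasingFactorization (permColorWord σ))
    (fun h => (((increasingFactorization_eq_iff _ _).1 rfl).2.1 [] h).elim)
    (by rw [((increasingFactorization_eq_iff _ _).1 rfl).1]; simp [permColorWord])

/-- The descent composition `D(τ)`: the sizes of the maximal increasing factors of `τ`. -/
def descentComposition {n : ℕ} (τ : Equiv.Perm (Fin n)) : Composition n :=
  sizesComposition ((permWord τ).splitBy fun a b => decide (a < b))
    (List.nil_notMem_splitBy _ _)
    (by rw [List.flatten_splitBy]; simp [permWord])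

/-- `Des(I) = {i₁, i₁ + i₂, …, i₁ + ⋯ + i_{s-1}}` for `I = (i₁, …, i_s)`. -/
def Des {n : ℕ} (I : Composition n) : Finset ℕ :=
  (Finset.Ico 1 I.length).image I.sizeUpTo

/-- `Des(I)⁻ = {d - 1 : d ∈ Des(I)}` (all elements of `Des(I)` are positive). -/
def DesPred {n : ℕ} (I : Composition n) : Finset ℕ :=
  (Des I).image fun d => d - 1

/-! ### The colored ribbons and their coefficients -/

/-- `R_I^u`: the sum of the `G_{τ,u}` over the permutations `τ` with descent composition `I`. -/
def ribbonWord (R : Type*) [CommRing R] {n r : ℕ} (I : Composition n) (u : List (Fin r)) :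
    FQSym R r :=
  ∑ τ : Equiv.Perm (Fin n) with descentComposition τ = I, biwordG R (permWord τ) u

/-- `R_I^{(J)}`: the sum of the `R_I^σ` over the permutations `σ` with saillance
composition `J`. -/
def coloredRibbon (R : Type*) [CommRing R] {n : ℕ} (I J : Composition n) : FQSym R n :=
  ∑ σ : Equiv.Perm (Fin n) with saillanceComposition σ = J, ribbonWord R I (permColorWord σ)

/-- The coefficient `c_{IJ}(q)`. -/
def ribbonCoeff {R : Type*} [CommRing R] {n : ℕ} (q : R) (I J : Composition n) : R :=
  if Des I \ DesPred I ⊆ Des J then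
    (-q) ^ (Des I \ Des J).card * (1 - q) ^ (Des I ∩ Des J).card
  else 0

/-! Both sides are compared at each colored word `w`. Both vanish unless the colors of `w` form a
permutation, so the colors may be taken distinct.

In the nested bracket each new biletter has the largest bottom so far, and it is attached on the
right with coefficient 1 or on the left with coefficient -q. The words that occur therefore decrease
and then increase, with a factor -q per descent (`coeff_nestedBracket`). Standardization transports
this to `w`, as a strict decrease followed by a weak increase. The bottom of such a valley carries
the label 1, so its color is the first letter of the only v for which Ψ^v can see the word, and v is
initially dominated exactly when this color is the largest one in the word (`sum_Psi_apply`). Hence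
the left side at `w` is a weighted sum over factorizations of `w` into valleys, each with its
largest color at its bottom, the bottom colors increasing from block to block (`psiSum_eq_sum`).

That sum is evaluated letter by letter. Let p be the last letter read and m the largest color so
far. Either the current block has its bottom, of color m, behind it, or a decreasing run is in
progress whose bottom is still to come and must have a color above m. Neither contribution obeys a
scalar recursion, but their sum `stateSum` does (`stateSum_cons`): reading a letter multiplies by 1
at an ascent, and at a descent by 1-q if the new color is a record, by -q if it is not but another
descent follows, and by 0 otherwise.

Descents of `w` are the elements of Des(I), records of the color word are those of Des(J), and the
product of these local factors is c_{IJ}(q) (`ite_pow_mul_pow_eq_prod`). -/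

/-- The sign-weight of a word that decreases strictly and then increases weakly. -/
def valleyWeight {R γ : Type*} [CommRing R] (q : R) (f : γ → ℕ) : List γ → R
  | [] => 0
  | [_] => 1
  | x :: y :: l =>
    if f x ≤ f y then (if (y :: l).IsChain (fun a b => f a ≤ f b) then 1 else 0)
    else -q * valleyWeight q f (y :: l)

/-- The letter following the first maximal strictly decreasing run of steps. -/
def valleyBottom {γ : Type*} (f : γ → ℕ) : γ → List γ → γ
  | x, [] => x
  | x, y :: l => if f x ≤ f y then x else valleyBottom f y l

/-! ### Valley-shaped words and their weights -/

section Valley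

variable {R γ δ : Type*} [CommRing R] (q : R) (f : γ → ℕ)

theorem valleyWeight_map (g : δ → γ) (l : List δ) :
    valleyWeight q f (l.map g) = valleyWeight q (f ∘ g) l := by
  induction l with
  | nil => rfl
  | cons x l ih =>
    cases l with
    | nil => rfl
    | cons y l =>
      simp only [List.map_cons] at ih ⊢
      rw [valleyWeight, valleyWeight, ih, ← List.map_cons]
      simp only [List.isChain_map]
      rfl

theorem valleyBottom_map (g : δ → γ) (x : δ) (l : List δ) :
    valleyBottom f (g x) (l.map g) = g (valleyBottom (f ∘ g) x l) := by
  induction l generalizing x with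
  | nil => rfl
  | cons y l ih =>
    rw [List.map_cons, valleyBottom, valleyBottom, ih]
    split_ifs with h1 h2 h2 <;> first | rfl | exact absurd h1 h2 | exact absurd h2 h1

theorem isChain_le_congr {g : γ → ℕ} {l : List γ}
    (h : l.Pairwise fun a b => f a ≤ f b ↔ g a ≤ g b) :
    l.IsChain (fun a b => f a ≤ f b) ↔ l.IsChain (fun a b => g a ≤ g b) := by
  induction l with
  | nil => simp
  | cons x l ih =>
    cases l with
    | nil => simp
    | cons y l =>
      rw [List.pairwise_cons] at h
      rw [List.isChain_cons_cons, List.isChain_cons_cons, ih h.2, h.1 y (by simp)]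

/-- Only comparisons of an earlier letter with a later one enter the weight, and these are what
standardization preserves. -/
theorem valleyWeight_congr {g : γ → ℕ} {l : List γ}
    (h : l.Pairwise fun a b => f a ≤ f b ↔ g a ≤ g b) :
    valleyWeight q f l = valleyWeight q g l := by
  induction l with
  | nil => rfl
  | cons x l ih =>
    cases l with
    | nil => rfl
    | cons y l =>
      rw [List.pairwise_cons] at h
      rw [valleyWeight, valleyWeight, ih h.2]
      simp only [h.1 y (by simp), isChain_le_congr f h.2]

theorem valleyBottom_congr {g : γ → ℕ} {x : γ} {l : List γ}
    (h : (x :: l).Pairwise fun a b => f a ≤ f b ↔ g a ≤ g b) :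
    valleyBottom f x l = valleyBottom g x l := by
  induction l generalizing x with
  | nil => rfl
  | cons y l ih =>
    rw [List.pairwise_cons] at h
    rw [valleyBottom, valleyBottom, ih h.2]
    simp only [h.1 y (by simp)]

theorem valleyBottom_mem (x : γ) (l : List γ) : valleyBottom f x l ∈ x :: l := by
  induction l generalizing x with
  | nil => simp [valleyBottom]
  | cons y l ih =>
    rw [valleyBottom]
    split_ifs
    · simp
    · exact List.mem_cons_of_mem _ (ih y)

/-- The word decreases down to the bottom, and a nonzero weight forces it to increase weakly from
there on. -/
theorem valleyBottom_le {x : γ} {l : List γ} (h : valleyWeight q f (x :: l) ≠ 0) :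
    ∀ y ∈ x :: l, f (valleyBottom f x l) ≤ f y := by
  induction l generalizing x with
  | nil => simp [valleyBottom]
  | cons y l ih =>
    rw [valleyWeight] at h
    rw [valleyBottom]
    split_ifs at h ⊢ with h1 h2
    · have hc : (x :: y :: l).IsChain (fun a b => f a ≤ f b) := by
        rw [List.isChain_cons_cons]; exact ⟨h1, h2⟩
      have : IsTrans γ (fun a b => f a ≤ f b) := ⟨fun _ _ _ => le_trans⟩
      rw [List.isChain_iff_pairwise, List.pairwise_cons] at hc
      intro z hz
      rcases List.mem_cons.1 hz with rfl | hz
      · exact le_rfl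
      · exact hc.1 z hz
    · exact absurd rfl h
    · have ih' := ih (x := y) (fun h0 => h (by rw [h0, mul_zero]))
      intro z hz
      rcases List.mem_cons.1 hz with rfl | hz
      · exact (ih' y (by simp)).trans (le_of_not_ge h1)
      · exact ih' z hz

/-- A strict maximum in front costs one descent; at the end it is free, and in the interior it
destroys the valley (the next two lemmas). These match the two terms of a q-bracket and the absence
of any other. -/
theorem valleyWeight_cons_of_lt {x : γ} {l : List γ} (hl : l ≠ []) (h : ∀ y ∈ l, f y < f x) :
    valleyWeight q f (x :: l) = -q * valleyWeight q f l := by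
  cases l with
  | nil => exact absurd rfl hl
  | cons y l =>
    rw [valleyWeight, if_neg (not_le.2 (h y (by simp)))]

theorem valleyWeight_append_of_lt {x : γ} {l : List γ} (hl : l ≠ []) (h : ∀ y ∈ l, f y < f x) :
    valleyWeight q f (l ++ [x]) = valleyWeight q f l := by
  induction l with
  | nil => exact absurd rfl hl
  | cons y l ih =>
    cases l with
    | nil => simp [valleyWeight, (h y (by simp)).le]
    | cons z l =>
      have hx : ∀ a, (z :: l).getLast? = some a → f a ≤ f x := fun a ha =>
        (h a (List.mem_cons_of_mem _ (List.mem_of_getLast? ha))).le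
      simp only [List.cons_append] at ih ⊢
      rw [valleyWeight, valleyWeight, ih (by simp) fun a ha => h a (List.mem_cons_of_mem _ ha),
        ← List.cons_append]
      have : ((z :: l).IsChain (fun a b => f a ≤ f b) ∧ [x].IsChain (fun a b => f a ≤ f b) ∧
          ∀ a ∈ (z :: l).getLast?, ∀ b ∈ [x].head?, f a ≤ f b) ↔
          (z :: l).IsChain (fun a b => f a ≤ f b) := by
        simpa using fun _ => by simpa using hx
      simp only [List.isChain_append, this]

theorem valleyWeight_append_cons_of_lt {x : γ} {l r : List γ} (hl : l ≠ []) (hr : r ≠ [])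
    (h : ∀ y ∈ l, f y < f x) (h' : ∀ y ∈ r, f y < f x) :
    valleyWeight q f (l ++ x :: r) = 0 := by
  have hc : ∀ l : List γ, ¬ (l ++ x :: r).IsChain (fun a b => f a ≤ f b) := by
    intro l hl
    obtain ⟨z, r, rfl⟩ := List.exists_cons_of_ne_nil hr
    have := (List.isChain_append.1 hl).2.1
    rw [List.isChain_cons_cons] at this
    exact absurd this.1 (not_le.2 (h' z (by simp)))
  induction l with
  | nil => exact absurd rfl hl
  | cons y l ih =>
    cases l with
    | nil =>
      have := hc []
      simp only [List.nil_append] at this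
      simp [valleyWeight, (h y (by simp)).le, this]
    | cons z l =>
      have := hc (z :: l)
      simp only [List.cons_append] at ih this ⊢
      rw [valleyWeight, ih (by simp) fun a ha => h a (List.mem_cons_of_mem _ ha), if_neg this]
      simp

end Valley

/-! ### Coefficients of the nested q-bracket -/

section Bracket

variable {R : Type*} [CommRing R] {r : ℕ} (q : R)

theorem coeff_mul_biletter_append (X : MonoidAlgebra R (FreeMonoid (Fin r × ℕ)))
    (l : List (Fin r × ℕ)) (b : Fin r × ℕ) :
    (X * biletter R b).coeff (FreeMonoid.ofList (l ++ [b])) = X.coeff (FreeMonoid.ofList l) := by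
  have := MonoidAlgebra.coeff_mul_single_eq_coeff_mul (R := R) (x := X) (m := FreeMonoid.of b)
    (m₁ := FreeMonoid.ofList (l ++ [b])) (r := 1) (FreeMonoid.ofList l) (fun m' _ => by
      rw [FreeMonoid.ofList_append, FreeMonoid.ofList_singleton, mul_left_inj])
  rw [mul_one] at this
  exact this

theorem coeff_mul_biletter_of_ne (X : MonoidAlgebra R (FreeMonoid (Fin r × ℕ)))
    (l : List (Fin r × ℕ)) (b : Fin r × ℕ) (h : ∀ l', l ≠ l' ++ [b]) :
    (X * biletter R b).coeff (FreeMonoid.ofList l) = 0 :=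
  MonoidAlgebra.coeff_mul_single_of_forall_mul_ne _ _ fun d hd => h d.toList hd.symm

theorem coeff_biletter_mul_cons (X : MonoidAlgebra R (FreeMonoid (Fin r × ℕ)))
    (l : List (Fin r × ℕ)) (b : Fin r × ℕ) :
    (biletter R b * X).coeff (FreeMonoid.ofList (b :: l)) = X.coeff (FreeMonoid.ofList l) := by
  have := MonoidAlgebra.coeff_single_mul_eq_mul_coeff (R := R) (x := X) (m := FreeMonoid.of b)
    (m₁ := FreeMonoid.ofList (b :: l)) (r := 1) (FreeMonoid.ofList l) (fun m' _ => by
      rw [FreeMonoid.ofList_cons, mul_right_inj])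
  rw [one_mul] at this
  exact this

theorem coeff_biletter_mul_of_ne (X : MonoidAlgebra R (FreeMonoid (Fin r × ℕ)))
    (l : List (Fin r × ℕ)) (b : Fin r × ℕ) (h : ∀ l', l ≠ b :: l') :
    (biletter R b * X).coeff (FreeMonoid.ofList l) = 0 :=
  MonoidAlgebra.coeff_single_mul_of_forall_mul_ne _ _ fun d hd => h d.toList hd.symm

theorem nestedBracket_concat (b : Fin r × ℕ) (bs : List (Fin r × ℕ)) (c : Fin r × ℕ) :
    nestedBracket q (b :: (bs ++ [c])) =
      qBracket q (nestedBracket q (b :: bs)) (biletter R c) := by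
  simp [nestedBracket]

/-- The coefficients of a nested bracket of biletters with increasing bottoms. -/
theorem coeff_nestedBracket (b : Fin r × ℕ) (bs : List (Fin r × ℕ))
    (h : (b :: bs).Pairwise fun x y => x.2 < y.2) (l : List (Fin r × ℕ)) :
    (nestedBracket q (b :: bs)).coeff (FreeMonoid.ofList l) =
      if l.Perm (b :: bs) then valleyWeight q Prod.snd l else 0 := by
  induction bs using List.reverseRecOn generalizing l with
  | nil =>
    change (MonoidAlgebra.single (FreeMonoid.of b) (1 : R)).coeff (FreeMonoid.ofList l) = _
    rw [MonoidAlgebra.coeff_single]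
    by_cases hl : l = [b]
    · subst hl
      simp [valleyWeight]
    · rw [if_neg (fun hp => hl (List.perm_singleton.1 hp)), Finsupp.single_eq_of_ne]
      intro hb
      exact hl (congrArg FreeMonoid.toList hb)
  | append_singleton bs c ih =>
    rw [← List.cons_append, List.pairwise_append] at h
    have hc : ∀ y ∈ b :: bs, y.2 < c.2 := fun y hy => h.2.2 y hy c (by simp)
    have ih := ih h.1
    rw [nestedBracket_concat, qBracket, sub_eq_add_neg, MonoidAlgebra.coeff_add, Finsupp.add_apply,
      ← neg_smul, MonoidAlgebra.coeff_smul_apply, smul_eq_mul]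
    have hperm : ∀ l, (l ++ [c]).Perm (b :: (bs ++ [c])) ↔ l.Perm (b :: bs) := by
      intro l
      rw [← List.cons_append, List.perm_append_right_iff]
    have hperm' : ∀ l, (c :: l).Perm (b :: (bs ++ [c])) ↔ l.Perm (b :: bs) := by
      intro l
      rw [← hperm]
      exact ⟨fun h => (List.perm_append_singleton c l).trans h,
        fun h => (List.perm_append_singleton c l).symm.trans h⟩
    -- The letter `c` has the largest bottom. If it is last only the product with `c` on the right
    -- contributes, if it is first only the one with `c` on the left; in the interior neither does,
    -- and the weight is zero.
    by_cases h1 : ∃ l', l = l' ++ [c]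
    · obtain ⟨l', rfl⟩ := h1
      rw [coeff_mul_biletter_append, if_congr (hperm l') rfl rfl, ih]
      by_cases hp : l'.Perm (b :: bs)
      · have hl' : l' ≠ [] := by rintro rfl; simp at hp
        have hlt : ∀ y ∈ l', y.2 < c.2 := fun y hy => hc y (hp.mem_iff.1 hy)
        rw [if_pos hp, if_pos hp, valleyWeight_append_of_lt q _ hl' hlt,
          coeff_biletter_mul_of_ne, mul_zero, add_zero]
        intro l'' he
        obtain ⟨z, l', rfl⟩ := List.exists_cons_of_ne_nil hl'
        have : z = c := by simpa using (List.cons.inj he).1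
        exact absurd (hlt z (by simp)) (by simp [this])
      · rw [if_neg hp, if_neg hp, zero_add]
        -- A word that is not a rearrangement may both begin and end with `c`, so the second product
        -- must be excluded separately.
        by_cases h2 : ∃ l'', l' ++ [c] = c :: l''
        · obtain ⟨l'', he⟩ := h2
          rw [he, coeff_biletter_mul_cons, ih, if_neg, mul_zero]
          rwa [← hperm', ← he, hperm]
        · rw [coeff_biletter_mul_of_ne _ _ _ (by simpa using h2), mul_zero]
    · rw [coeff_mul_biletter_of_ne _ _ _ (by simpa using h1), zero_add]
      by_cases h2 : ∃ l'', l = c :: l''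
      · obtain ⟨l', rfl⟩ := h2
        rw [coeff_biletter_mul_cons, if_congr (hperm' l') rfl rfl, ih]
        by_cases hp : l'.Perm (b :: bs)
        · have hl' : l' ≠ [] := by rintro rfl; simp at hp
          rw [if_pos hp, if_pos hp, valleyWeight_cons_of_lt q _ hl']
          exact fun y hy => hc y (hp.mem_iff.1 hy)
        · rw [if_neg hp, if_neg hp, mul_zero]
      · rw [coeff_biletter_mul_of_ne _ _ _ (by simpa using h2), mul_zero]
        split_ifs with hp
        · obtain ⟨s, t, rfl⟩ := List.append_of_mem (hp.mem_iff.2 (by simp : c ∈ b :: (bs ++ [c])))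
          have hst : (s ++ t).Perm (b :: bs) := (hperm' _).1 (List.perm_middle.symm.trans hp)
          refine (valleyWeight_append_cons_of_lt q _ ?_ ?_ ?_ ?_).symm
          · rintro rfl; exact h2 ⟨t, rfl⟩
          · rintro rfl; exact h1 ⟨s, rfl⟩
          · exact fun y hy => hc y (hst.mem_iff.1 (by simp [hy]))
          · exact fun y hy => hc y (hst.mem_iff.1 (by simp [hy]))
        · rfl

end Bracket

/-! ### Standardization preserves weak comparisons from left to right -/

section Standardization

/-- The value of the standardization of `l` at position `i`. -/
def standardRank (l : List ℕ) (i : Fin l.length) : ℕ :=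
  (Finset.univ.filter fun j : Fin l.length => l.get j < l.get i ∨ (l.get j = l.get i ∧ j ≤ i)).card

theorem length_standardization (l : List ℕ) : (standardization l).length = l.length := by
  simp [standardization]

theorem getElem_standardization (l : List ℕ) (i : ℕ) (h : i < (standardization l).length) :
    (standardization l)[i] = standardRank l ⟨i, length_standardization l ▸ h⟩ := by
  simp [standardization, standardRank]

theorem standardRank_lt_of_lt (l : List ℕ) {i j : Fin l.length}
    (h : l.get i < l.get j ∨ (l.get i = l.get j ∧ i < j)) : standardRank l i < standardRank l j := by
  refine Finset.card_lt_card ⟨?_, ?_⟩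
  · intro k hk
    simp only [Finset.mem_filter, Finset.mem_univ, true_and] at hk ⊢
    omega
  · intro hsub
    have := hsub (show j ∈ _ by simp)
    simp only [Finset.mem_filter, Finset.mem_univ, true_and] at this
    omega

/-- Equal letters are numbered from left to right, so a tie becomes an ascent; this needs `i` to lie
before `j`. -/
theorem standardRank_le_iff (l : List ℕ) {i j : Fin l.length} (hij : i < j) :
    standardRank l i ≤ standardRank l j ↔ l.get i ≤ l.get j := by
  constructor
  · intro h
    by_contra h'
    exact absurd (standardRank_lt_of_lt l (Or.inl (not_le.1 h'))) (not_lt.2 h)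
  · intro h
    refine (standardRank_lt_of_lt l ?_).le
    omega

theorem standardRank_injective (l : List ℕ) : Function.Injective (standardRank l) := by
  intro i j h
  by_contra hne
  have : (l.get i < l.get j ∨ (l.get i = l.get j ∧ i < j)) ∨
      (l.get j < l.get i ∨ (l.get j = l.get i ∧ j < i)) := by omega
  rcases this with h' | h' <;> have := standardRank_lt_of_lt l h' <;> omega

theorem standardization_le_iff (l : List ℕ) {i j : ℕ} (hij : i < j) (hj : j < l.length) :
    (standardization l)[i]'(by rw [length_standardization]; omega) ≤
      (standardization l)[j]'(by rw [length_standardization]; omega) ↔ l[i] ≤ l[j] := by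
  rw [getElem_standardization, getElem_standardization, standardRank_le_iff]
  · rfl
  · exact hij

theorem standardization_perm (l : List ℕ) : (standardization l).Perm (List.range' 1 l.length) := by
  have hn : (standardization l).Nodup := List.nodup_ofFn.2 (standardRank_injective l)
  refine List.Subperm.perm_of_length_le (hn.subperm ?_) (by simp [length_standardization])
  intro x hx
  obtain ⟨i, rfl⟩ := (List.mem_ofFn' _ _).1 hx
  rw [List.mem_range'_1]
  have h1 : 0 < standardRank l i := Finset.card_pos.2 ⟨i, by simp⟩
  have h2 : standardRank l i ≤ l.length := (Finset.card_le_univ _).trans (by simp)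
  change 1 ≤ standardRank l i ∧ standardRank l i < 1 + l.length
  omega

end Standardization

/-! ### Coefficients of Ψ at a colored word -/

section PsiCoeff

variable {R : Type*} [CommRing R] {r : ℕ} (q : R)

/-- The biword attached to a colored word: its colors on top of its standardization. -/
def standardBiword (w : List (ℕ × Fin r)) : List (Fin r × ℕ) :=
  (w.map Prod.snd).zip (standardization (w.map Prod.fst))

theorem standardBiword_map_fst (w : List (ℕ × Fin r)) :
    (standardBiword w).map Prod.fst = w.map Prod.snd :=
  List.map_fst_zip (by simp [length_standardization])

theorem standardBiword_map_snd (w : List (ℕ × Fin r)) :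
    (standardBiword w).map Prod.snd = standardization (w.map Prod.fst) :=
  List.map_snd_zip (by simp [length_standardization])

/-- Among the G indexed by biwords, a colored word occurs in exactly one, that of its own biword.
Coefficients of interpreted elements are thus read off at `standardBiword w`. -/
theorem gSeries_apply (l : List (Fin r × ℕ)) (w : List (ℕ × Fin r)) :
    gSeries R (l.map Prod.snd) (l.map Prod.fst) w = if l = standardBiword w then 1 else 0 := by
  unfold gSeries
  refine if_congr ⟨?_, ?_⟩ rfl rfl
  · rintro ⟨h1, h2⟩
    rw [standardBiword, h1, h2]
    exact List.zip_of_prod rfl rfl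
  · rintro rfl
    exact ⟨(standardBiword_map_snd w).symm, (standardBiword_map_fst w).symm⟩

theorem interpretBiwords_apply (X : MonoidAlgebra R (FreeMonoid (Fin r × ℕ)))
    (w : List (ℕ × Fin r)) :
    (interpretBiwords R r X).1 w = X.coeff (FreeMonoid.ofList (standardBiword w)) := by
  induction X using MonoidAlgebra.induction_linear with
  | zero => simp [WordSeries.zero_apply]
  | add f g hf hg =>
    rw [map_add, MonoidAlgebra.coeff_add, Finsupp.add_apply, ← hf, ← hg]
    rfl
  | single m c =>
    have : interpretBiwords R r (MonoidAlgebra.single m c) =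
        c • biwordG R (m.toList.map Prod.snd) (m.toList.map Prod.fst) := by
      simp [interpretBiwords, MonoidAlgebra.coeffLinearEquiv]
    rw [this]
    change c * gSeries R (m.toList.map Prod.snd) (m.toList.map Prod.fst) w = _
    rw [gSeries_apply, MonoidAlgebra.coeff_single]
    by_cases h : m.toList = standardBiword w
    · rw [if_pos h, ← h]
      simp
    · rw [if_neg h, Finsupp.single_eq_of_ne, mul_zero]
      exact fun h' => h (congrArg FreeMonoid.toList h').symm

theorem pairwise_zipIdx {α : Type*} (v : List α) (k : ℕ) :
    (v.zipIdx k).Pairwise fun x y => x.2 < y.2 := by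
  have := List.pairwise_lt_range' (s := k) (n := v.length) (step := 1)
  rw [← List.zipIdx_map_snd, List.pairwise_map] at this
  exact this

/-- A colored word together with its standardization. -/
theorem exists_standard_triples (w : List (ℕ × Fin r)) : ∃ z : List ((ℕ × Fin r) × ℕ),
    z.map Prod.fst = w ∧ z.map (fun x => (x.1.2, x.2)) = standardBiword w ∧
      z.Pairwise fun x y => x.2 ≤ y.2 ↔ x.1.1 ≤ y.1.1 := by
  have hl : w.length = (standardization (w.map Prod.fst)).length := by
    simp [length_standardization]
  refine ⟨w.zip (standardization (w.map Prod.fst)), List.map_fst_zip hl.le, ?_, ?_⟩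
  · rw [standardBiword, List.zip_map_left]
    rfl
  · rw [List.pairwise_iff_getElem]
    intro i j hi hj hij
    rw [List.length_zip, ← hl, min_self] at hi hj
    rw [List.getElem_zip, List.getElem_zip]
    have := standardization_le_iff (w.map Prod.fst) hij (by simpa using hj)
    simpa using this

theorem valleyWeight_standardBiword (w : List (ℕ × Fin r)) :
    valleyWeight q Prod.snd (standardBiword w) = valleyWeight q Prod.fst w := by
  obtain ⟨z, h1, h2, h3⟩ := exists_standard_triples w
  rw [← h2, valleyWeight_map]
  conv_rhs => rw [← h1, valleyWeight_map]
  exact valleyWeight_congr q _ h3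

theorem Psi_apply {v : List (Fin r)} (hv : v ≠ []) (w : List (ℕ × Fin r)) :
    (Psi q v).1 w =
      if (standardBiword w).Perm (v.zipIdx 1) then valleyWeight q Prod.fst w else 0 := by
  obtain ⟨c, v, rfl⟩ := List.exists_cons_of_ne_nil hv
  have h := pairwise_zipIdx (c :: v) 1
  rw [Psi, interpretBiwords_apply, ← valleyWeight_standardBiword]
  rw [List.zipIdx_cons] at h ⊢
  exact coeff_nestedBracket q _ _ h _

theorem Psi_apply_eq_zero {v : List (Fin r)} (hv : v ≠ []) {w : List (ℕ × Fin r)}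
    (h : ¬ v.Perm (w.map Prod.snd)) : (Psi q v).1 w = 0 := by
  rw [Psi_apply q hv, if_neg]
  intro hp
  refine h ?_
  have := hp.map Prod.fst
  rw [standardBiword_map_fst, List.zipIdx_map_fst] at this
  exact this.symm

/-- Sorting by bottoms turns the labels into 1, 2, …, and the top row becomes the color word. With
`zipIdx_perm_inj`, a given colored word is seen by at most one Ψ^v. -/
theorem exists_perm_zipIdx {α : Type*} {l : List (α × ℕ)}
    (h : (l.map Prod.snd).Perm (List.range' 1 l.length)) : ∃ v : List α, l.Perm (v.zipIdx 1) := by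
  set m := l.mergeSort (fun x y => decide (x.2 ≤ y.2)) with hm
  have hp : m.Perm l := List.mergeSort_perm _ _
  have hs : m.Pairwise fun x y => x.2 ≤ y.2 := by
    have := List.pairwise_mergeSort (le := fun x y : α × ℕ => decide (x.2 ≤ y.2))
      (by simpa using fun _ _ _ _ _ _ => le_trans)
      (by simpa using fun _ a _ b => le_total a b) l
    simpa using this
  have hr : m.map Prod.snd = List.range' 1 m.length := by
    refine List.Perm.eq_of_pairwise (le := (· ≤ ·)) (fun a b _ _ => le_antisymm) ?_ ?_ ?_
    · rw [List.pairwise_map]; exact hs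
    · exact (List.pairwise_lt_range' (step := 1)).imp fun h => le_of_lt h
    · rw [hp.length_eq]; exact (hp.map _).trans h
  refine ⟨m.map Prod.fst, ?_⟩
  rw [List.zipIdx_eq_zip_range', List.length_map, ← hr,
    ← List.zip_of_prod rfl rfl]
  exact hp.symm

theorem zipIdx_perm_inj {α : Type*} {v v' : List α} (h : (v.zipIdx 1).Perm (v'.zipIdx 1)) :
    v = v' := by
  have := List.Perm.eq_of_pairwise (le := fun x y : α × ℕ => x.2 < y.2)
    (fun a b _ _ h1 h2 => absurd h1 h2.asymm) (pairwise_zipIdx v 1) (pairwise_zipIdx v' 1) h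
  have := congrArg (List.map Prod.fst) this
  simpa using this

/-- The bottom of the valley has the least label, and the label 1 belongs to the first letter of the
color word. -/
theorem valleyBottom_eq_head {x : ℕ × Fin r} {l : List (ℕ × Fin r)} {c : Fin r} {v : List (Fin r)}
    (hp : (standardBiword (x :: l)).Perm ((c :: v).zipIdx 1))
    (h0 : valleyWeight q Prod.fst (x :: l) ≠ 0) : (valleyBottom Prod.fst x l).2 = c := by
  obtain ⟨z, h1, h2, h3⟩ := exists_standard_triples (x :: l)
  rw [← valleyWeight_standardBiword, ← h2] at h0
  rw [← h2] at hp
  cases z with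
  | nil => simp at h1
  | cons y z =>
    rw [List.map_cons, List.cons.injEq] at h1
    obtain ⟨rfl, rfl⟩ := h1
    rw [List.map_cons] at hp h0
    have hle := valleyBottom_le q Prod.snd h0
    have hmem := valleyBottom_mem (Prod.snd : Fin r × ℕ → ℕ) (y.1.2, y.2)
      (z.map fun x => (x.1.2, x.2))
    have key : valleyBottom (Prod.snd : Fin r × ℕ → ℕ) (y.1.2, y.2)
      (z.map fun x => (x.1.2, x.2)) = (c, 1) := by
      have hle' := hle (c, 1) (hp.mem_iff.2 (by simp))
      rw [hp.mem_iff, List.zipIdx_cons, List.mem_cons] at hmem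
      rcases hmem with h | h
      · exact h
      · have := (List.mem_zipIdx (x := (valleyBottom Prod.snd _ _).1)
          (i := (valleyBottom Prod.snd _ _).2) h).1
        omega
    have e1 := valleyBottom_map (Prod.snd : Fin r × ℕ → ℕ) (fun x : (ℕ × Fin r) × ℕ => (x.1.2, x.2))
      y z
    have e2 := valleyBottom_map (Prod.fst : ℕ × Fin r → ℕ) (Prod.fst : (ℕ × Fin r) × ℕ → _) y z
    rw [e2]
    have e3 : valleyBottom (Prod.fst ∘ (Prod.fst : (ℕ × Fin r) × ℕ → _)) y z =
        valleyBottom (Prod.snd ∘ fun x : (ℕ × Fin r) × ℕ => (x.1.2, x.2)) y z :=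
      (valleyBottom_congr _ h3).symm
    rw [e3]
    have := e1.symm.trans key
    exact congrArg Prod.fst this

/-- The first letter of `v`, if any, is at least `b`. -/
def HeadGE (b : ℕ) (v : List (Fin r)) : Prop := ∀ c ∈ v.head?, b ≤ (c : ℕ)

open Classical in
/-- The sum of the coefficients of the `Ψ^v` at a colored word, over initially dominated words `v`
with a given lower bound on their first letters. -/
theorem sum_Psi_apply {x : ℕ × Fin r} {l : List (ℕ × Fin r)}
    (hn : ((x :: l).map Prod.snd).Nodup) (b : ℕ) (F : List (Fin r) → R) (G : Fin r → R)
    (hF : ∀ c v, F (c :: v) = G c) :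
    ∑ v ∈ ((x :: l).map Prod.snd).permutations.toFinset with
        InitiallyDominated v ∧ HeadGE b v, (Psi q v).1 (x :: l) * F v =
      if (∀ d ∈ (x :: l).map Prod.snd, d ≤ (valleyBottom Prod.fst x l).2) ∧
          b ≤ ((valleyBottom Prod.fst x l).2 : ℕ) then
        valleyWeight q Prod.fst (x :: l) * G (valleyBottom Prod.fst x l).2 else 0 := by
  obtain ⟨v, hv⟩ := exists_perm_zipIdx (l := standardBiword (x :: l)) (by
    rw [standardBiword_map_snd]
    have := standardization_perm ((x :: l).map Prod.fst)
    simpa [standardBiword, length_standardization] using this)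
  have hperm : v.Perm ((x :: l).map Prod.snd) := by
    have := hv.map Prod.fst
    rw [standardBiword_map_fst, List.zipIdx_map_fst] at this
    exact this.symm
  cases v with
  | nil => simp at hperm
  | cons c v =>
    -- Off the valleys `valleyBottom` need not be a minimum, but there both sides vanish.
    by_cases h0 : valleyWeight q Prod.fst (x :: l) = 0
    · rw [h0, zero_mul, ite_self]
      refine Finset.sum_eq_zero fun u hu => ?_
      have hu0 : u ≠ [] := by
        rintro rfl
        exact (Finset.mem_filter.1 hu).2.1
      rw [Psi_apply q hu0, h0, ite_self, zero_mul]
    · rw [valleyBottom_eq_head q hv h0]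
      have hdom : InitiallyDominated (c :: v) ↔ ∀ d ∈ (x :: l).map Prod.snd, d ≤ c := by
        have hn' : c ∉ v := (List.nodup_cons.1 (hperm.nodup_iff.2 hn)).1
        constructor
        · intro h d hd
          rcases List.mem_cons.1 (hperm.mem_iff.2 hd) with rfl | hd
          · exact le_rfl
          · exact (h d hd).le
        · intro h d hd
          refine lt_of_le_of_ne (h d (hperm.mem_iff.1 (by simp [hd]))) ?_
          rintro rfl
          exact hn' hd
      rw [Finset.sum_filter, Finset.sum_eq_single (c :: v)]
      · rw [Psi_apply q (by simp), if_pos hv, hF]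
        refine if_congr ?_ rfl rfl
        rw [hdom]
        simp [HeadGE]
      · intro u _ hne
        split_ifs with hd
        · have hu0 : u ≠ [] := by
            rintro rfl
            exact hd.1
          rw [Psi_apply q hu0, if_neg, zero_mul]
          intro hp
          exact hne (zipIdx_perm_inj (hp.symm.trans hv))
        · rfl
      · intro h
        exact absurd (by simpa using hperm) h

end PsiCoeff

/-! ### Cutting off the first initially dominated factor -/

section Factorization

variable {r : ℕ}

/-- The first factor of the increasing factorization. -/
def firstFactor : List (Fin r) → List (Fin r)
  | [] => []
  | a :: l => a :: l.takeWhile fun b => decide (b < a)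

/-- What follows the first factor of the increasing factorization. -/
def restFactor : List (Fin r) → List (Fin r)
  | [] => []
  | a :: l => l.dropWhile fun b => decide (b < a)

theorem firstFactor_append_restFactor (u : List (Fin r)) : firstFactor u ++ restFactor u = u := by
  cases u with
  | nil => rfl
  | cons a l => simp [firstFactor, restFactor, List.takeWhile_append_dropWhile]

theorem firstFactor_ne_nil {u : List (Fin r)} (h : u ≠ []) : firstFactor u ≠ [] := by
  cases u with
  | nil => exact absurd rfl h
  | cons a l => simp [firstFactor]

theorem head?_firstFactor (u : List (Fin r)) : (firstFactor u).head? = u.head? := by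
  cases u <;> rfl

theorem initiallyDominated_firstFactor {u : List (Fin r)} (h : u ≠ []) :
    InitiallyDominated (firstFactor u) := by
  cases u with
  | nil => exact absurd rfl h
  | cons a l =>
    intro b hb
    simpa using List.mem_takeWhile_imp hb

theorem headGE_restFactor {a : Fin r} {u : List (Fin r)} (h : u.head? = some a) :
    HeadGE a (restFactor u) := by
  cases u with
  | nil => simp at h
  | cons a' l =>
    obtain rfl : a' = a := by simpa using h
    intro c hc
    have := List.head?_dropWhile_not (fun b => decide (b < a')) l
    have hc' : (l.dropWhile fun b => decide (b < a')).head? = some c := hc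
    rw [hc'] at this
    simpa using this

/-- Domination carries `takeWhile` through all of `v`, and the lower bound stops it at `u`. Cutting
is thus inverse to concatenating. -/
theorem factors_append {v u : List (Fin r)} (hv : InitiallyDominated v)
    (hu : ∀ a ∈ v.head?, HeadGE a u) : firstFactor (v ++ u) = v ∧ restFactor (v ++ u) = u := by
  cases v with
  | nil => exact hv.elim
  | cons a t =>
    have hall : ∀ b ∈ t, (fun b => decide (b < a)) b = true := fun b hb =>
      decide_eq_true (hv b hb)
    have hu' := hu a rfl
    rw [List.cons_append, firstFactor, restFactor, List.takeWhile_append_of_pos hall,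
      List.dropWhile_append_of_pos hall]
    cases u with
    | nil => simp
    | cons d m =>
      have : a ≤ d := hu' d rfl
      simp [this]

end Factorization

/-! ### The sum over σ as a sum over factorizations into valleys -/

section BlockProduct

variable {R : Type*} [CommRing R] {r : ℕ} (q : R)

/-- The product of the series `Ψ^v` over the factors `v` of the increasing factorization. -/
noncomputable def psiSeries (u : List (Fin r)) : WordSeries R (ℕ × Fin r) :=
  ((increasingFactorization u).map fun v => (Psi q v).1).prod

theorem psiSeries_nil : psiSeries q ([] : List (Fin r)) = 1 := by
  simp [psiSeries, increasingFactorization]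

theorem psiSeries_eq_mul {u : List (Fin r)} (h : u ≠ []) :
    psiSeries q u = (Psi q (firstFactor u)).1 * psiSeries q (restFactor u) := by
  cases u with
  | nil => exact absurd rfl h
  | cons a l =>
    rw [psiSeries, increasingFactorization]
    simp [psiSeries, firstFactor, restFactor]

theorem coe_PsiPerm {n : ℕ} (σ : Equiv.Perm (Fin n)) :
    (PsiPerm q σ).1 = psiSeries q (permColorWord σ) := by
  have := map_list_prod (FQSym R n).val ((increasingFactorization (permColorWord σ)).map (Psi q))
  rw [List.map_map] at this
  exact this

/-- Each factor only sees words colored by a rearrangement of its letters, and rearrangements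
concatenate. -/
theorem perm_of_psiSeries_ne_zero {u : List (Fin r)} {w : List (ℕ × Fin r)}
    (h : psiSeries q u w ≠ 0) : u.Perm (w.map Prod.snd) := by
  induction hk : u.length using Nat.strong_induction_on generalizing u w with
  | _ k ih =>
    by_cases hu : u = []
    · subst hu
      rw [psiSeries_nil] at h
      cases w with
      | nil => simp
      | cons x w => exact absurd (WordSeries.one_cons x w) h
    · rw [psiSeries_eq_mul q hu, WordSeries.mul_apply] at h
      obtain ⟨i, _, hi⟩ := Finset.exists_ne_zero_of_sum_ne_zero h
      have hf := firstFactor_append_restFactor u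
      have hl : 0 < (firstFactor u).length := List.length_pos_iff.2 (firstFactor_ne_nil hu)
      have hl' := congrArg List.length hf
      rw [List.length_append] at hl'
      have h1 : (firstFactor u).Perm ((w.take i).map Prod.snd) := by
        by_contra hc
        exact hi (by rw [Psi_apply_eq_zero q (firstFactor_ne_nil hu) hc, zero_mul])
      have h2 := ih (restFactor u).length (by omega) (u := restFactor u) (w := w.drop i)
        (fun hc => hi (by rw [hc, mul_zero])) rfl
      have := h1.append h2
      rwa [hf, ← List.map_append, List.take_append_drop] at this

open Classical in
/-- The sum of the coefficients of the `psiSeries` at a colored word, over the rearrangements of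
its colors whose first letter is at least `b`. -/
noncomputable def psiSum (b : ℕ) (w : List (ℕ × Fin r)) : R :=
  ∑ u ∈ (w.map Prod.snd).permutations.toFinset with HeadGE b u, psiSeries q u w

/-- The contribution to `psiSum` of a first factor with support `x :: l`. -/
noncomputable def blockWeight (b : ℕ) (x : ℕ × Fin r) (l : List (ℕ × Fin r)) : R :=
  if (∀ d ∈ (x :: l).map Prod.snd, d ≤ (valleyBottom Prod.fst x l).2) ∧
    b ≤ ((valleyBottom Prod.fst x l).2 : ℕ) then valleyWeight q Prod.fst (x :: l) else 0

theorem psiSum_nil (b : ℕ) : psiSum q b ([] : List (ℕ × Fin r)) = 1 := by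
  classical
  have : (([] : List (ℕ × Fin r)).map Prod.snd).permutations.toFinset = {[]} := by simp
  rw [psiSum, this, Finset.filter_singleton, if_pos (by simp [HeadGE]), Finset.sum_singleton,
    psiSeries_nil, WordSeries.one_nil]

-- Cutting `u` after its first factor reindexes the sum by pairs. Color words that do not rearrange
-- compatibly with the cut of the word have coefficient zero, so the two index sets need not match
-- exactly. Since colors are distinct, weakly increasing first letters increase strictly, hence the
-- bound `c + 1`, taken in ℕ.
open Classical in
theorem psiSum_eq_sum_aux (b : ℕ) {w w' : List (ℕ × Fin r)}
    (hn : ((w ++ w').map Prod.snd).Nodup) :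
    ∑ u ∈ ((w ++ w').map Prod.snd).permutations.toFinset with HeadGE b u,
        (if u = [] then 0 else (Psi q (firstFactor u)).1 w * psiSeries q (restFactor u) w') =
      ∑ v ∈ (w.map Prod.snd).permutations.toFinset with InitiallyDominated v ∧ HeadGE b v,
        (Psi q v).1 w * ∑ u ∈ (w'.map Prod.snd).permutations.toFinset with
          ∀ c ∈ v.head?, HeadGE (c + 1) u, psiSeries q u w' := by
  simp_rw [Finset.mul_sum]
  rw [Finset.sum_sigma']
  symm
  have hfac : ∀ p ∈ ((w.map Prod.snd).permutations.toFinset.filter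
      fun v => InitiallyDominated v ∧ HeadGE b v).sigma fun v =>
        (w'.map Prod.snd).permutations.toFinset.filter fun u => ∀ c ∈ v.head?, HeadGE (c + 1) u,
      firstFactor (p.1 ++ p.2) = p.1 ∧ restFactor (p.1 ++ p.2) = p.2 := by
    intro p hp
    simp only [Finset.mem_sigma, Finset.mem_filter] at hp
    exact factors_append hp.1.2.1 fun a ha c hc => (Nat.le_succ _).trans (hp.2.2 a ha c hc)
  refine Finset.sum_of_injOn (fun p => p.1 ++ p.2) ?_ ?_ ?_ ?_
  · intro p hp p' hp' he
    have h1 := hfac p hp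
    have h2 := hfac p' hp'
    have he' : p.1 ++ p.2 = p'.1 ++ p'.2 := he
    rw [he', h2.1, h2.2] at h1
    obtain ⟨v, u⟩ := p
    obtain ⟨v', u'⟩ := p'
    obtain ⟨rfl, rfl⟩ := h1
    rfl
  · intro p hp
    have hp' := hp
    simp only [Finset.coe_sigma, Set.mem_sigma_iff, Finset.mem_coe, Finset.mem_filter,
      List.mem_toFinset, List.mem_permutations] at hp'
    simp only [Finset.mem_coe, Finset.mem_filter, List.mem_toFinset, List.mem_permutations]
    refine ⟨by rw [List.map_append]; exact hp'.1.1.append hp'.2.1, ?_⟩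
    have hne : p.1 ≠ [] := by
      intro h
      exact (h ▸ hp'.1.2.1 : InitiallyDominated ([] : List (Fin r)))
    obtain ⟨c, t, hct⟩ := List.exists_cons_of_ne_nil hne
    have := hp'.1.2.2
    rw [hct] at this ⊢
    exact this
  · intro u hu hnot
    simp only [Finset.mem_filter, List.mem_toFinset, List.mem_permutations] at hu
    split_ifs with h0
    · rfl
    · by_contra hc
      refine hnot ⟨⟨firstFactor u, restFactor u⟩, ?_, firstFactor_append_restFactor u⟩
      simp only [Finset.coe_sigma, Set.mem_sigma_iff, Finset.mem_coe, Finset.mem_filter,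
        List.mem_toFinset, List.mem_permutations]
      refine ⟨⟨?_, initiallyDominated_firstFactor h0, ?_⟩, ?_, ?_⟩
      · by_contra hp
        exact hc (by rw [Psi_apply_eq_zero q (firstFactor_ne_nil h0) hp, zero_mul])
      · intro c hc
        rw [head?_firstFactor] at hc
        exact hu.2 c hc
      · exact perm_of_psiSeries_ne_zero q fun h => hc (by rw [h, mul_zero])
      · intro c hc d hd
        have h1 := headGE_restFactor ((head?_firstFactor u).symm.trans hc) d hd
        have h2 : c ≠ d := by
          have hun : u.Nodup := hu.1.nodup_iff.2 hn
          rw [← firstFactor_append_restFactor u, List.nodup_append] at hun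
          exact hun.2.2 c (List.mem_of_mem_head? hc) d (List.mem_of_mem_head? hd)
        have h3 : (c : ℕ) ≠ d := fun h => h2 (Fin.ext h)
        omega
  · intro p hp
    obtain ⟨h1, h2⟩ := hfac p hp
    simp only [Finset.mem_sigma, Finset.mem_filter] at hp
    rw [h1, h2, if_neg]
    intro h
    exact ((List.append_eq_nil_iff.1 h).1 ▸ hp.1.2.1 : InitiallyDominated ([] : List (Fin r)))

theorem psiSum_eq_sum (b : ℕ) (x : ℕ × Fin r) (l : List (ℕ × Fin r))
    (hn : ((x :: l).map Prod.snd).Nodup) :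
    psiSum q b (x :: l) = ∑ i ∈ Finset.range (l.length + 1),
      blockWeight q b x (l.take i) *
        psiSum q ((valleyBottom Prod.fst x (l.take i)).2 + 1) (l.drop i) := by
  classical
  have hmul : ∀ u ∈ (((x :: l).map Prod.snd).permutations.toFinset).filter (HeadGE b),
      psiSeries q u (x :: l) = ∑ i ∈ Finset.range (l.length + 1), if u = [] then 0 else
        (Psi q (firstFactor u)).1 (x :: l.take i) * psiSeries q (restFactor u) (l.drop i) := by
    intro u hu
    have hu0 : u ≠ [] := by
      rintro rfl
      simp at hu
    rw [psiSeries_eq_mul q hu0, WordSeries.mul_apply, List.length_cons, Finset.sum_range_succ']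
    simp only [if_neg hu0, List.take_succ_cons, List.drop_succ_cons, List.take_zero]
    -- The term with an empty first block drops out because the weight of the empty word is 0.
    rw [Psi_apply q (firstFactor_ne_nil hu0) []]
    simp [valleyWeight]
  rw [psiSum, Finset.sum_congr rfl hmul, Finset.sum_comm]
  refine Finset.sum_congr rfl fun i _ => ?_
  have hx : x :: l = (x :: l.take i) ++ l.drop i := by simp
  have hn' := hn
  rw [hx] at hn'
  have hn'' := hn'
  rw [List.map_append] at hn''
  -- The later factors depend on `v` only through its first letter, which bounds theirs from below;
  -- this is the role of `F` and `G`.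
  have key := sum_Psi_apply q (List.nodup_append.1 hn'').1 b
    (fun v => ∑ u ∈ ((l.drop i).map Prod.snd).permutations.toFinset with
          ∀ c ∈ v.head?, HeadGE (c + 1) u, psiSeries q u (l.drop i))
    (fun c => psiSum q (c + 1) (l.drop i)) (fun c v => by simp [psiSum])
  have := (psiSum_eq_sum_aux q b hn').trans key
  rw [← hx] at this
  rw [this, blockWeight, ite_mul, zero_mul]

/-- The part of `psiSum` where the current factor is continued by increasing steps. -/
noncomputable def tailSum (m : Fin r) (p : ℕ) (w : List (ℕ × Fin r)) : R :=
  ∑ i ∈ Finset.range (w.length + 1),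
    if (p :: (w.take i).map Prod.fst).IsChain (· ≤ ·) ∧ ∀ x ∈ w.take i, x.2 < m then
      psiSum q (m + 1) (w.drop i) else 0

theorem tailSum_nil (m : Fin r) (p : ℕ) : tailSum q m p [] = 1 := by
  simp [tailSum, psiSum_nil]

/-- Either the current block ends before the new letter, or it absorbs it, which requires a weak
ascent and a color below `m`. -/
theorem tailSum_cons (m : Fin r) (p : ℕ) (a : ℕ) (c : Fin r) (w : List (ℕ × Fin r)) :
    tailSum q m p ((a, c) :: w) = psiSum q (m + 1) ((a, c) :: w) +
      if p ≤ a ∧ c < m then tailSum q m a w else 0 := by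
  rw [tailSum, List.length_cons, Finset.sum_range_succ', add_comm]
  refine congrArg₂ _ ?_ ?_
  · simp
  · split_ifs with h
    · rw [tailSum]
      refine Finset.sum_congr rfl fun i _ => ?_
      refine if_congr ?_ (by rw [List.drop_succ_cons]) rfl
      rw [List.take_succ_cons, List.map_cons, List.isChain_cons_cons, List.forall_mem_cons]
      tauto
    · refine Finset.sum_eq_zero fun i _ => if_neg ?_
      simp only [List.take_succ_cons, List.map_cons, List.isChain_cons_cons, List.forall_mem_cons]
      tauto

/-- A letter followed by a smaller one is either a block by itself or the top of a decreasing run.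
In the second case removing it costs -q and keeps the bottom; its color survives only as a stricter
lower bound on the color of that bottom. -/
theorem psiSum_cons_of_lt (b a : ℕ) (c : Fin r) (a' : ℕ) (c' : Fin r) (w : List (ℕ × Fin r))
    (hn : (((a, c) :: (a', c') :: w).map Prod.snd).Nodup) (h : a' < a) :
    psiSum q b ((a, c) :: (a', c') :: w) =
      -q * psiSum q (max b (c + 1)) ((a', c') :: w) +
        if b ≤ c then tailSum q c a ((a', c') :: w) else 0 := by
  have hn' : (((a', c') :: w).map Prod.snd).Nodup := by
    rw [List.map_cons] at hn
    exact (List.nodup_cons.1 hn).2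
  rw [psiSum_eq_sum q _ _ _ hn, List.length_cons, Finset.sum_range_succ',
    psiSum_eq_sum q _ _ _ hn', Finset.mul_sum]
  congr 1
  · refine Finset.sum_congr rfl fun i _ => ?_
    rw [List.take_succ_cons, List.drop_succ_cons, ← mul_assoc]
    have hb : valleyBottom Prod.fst (a, c) ((a', c') :: w.take i) =
        valleyBottom Prod.fst (a', c') (w.take i) := by
      rw [valleyBottom, if_neg (not_le.2 h)]
    rw [hb]
    congr 1
    rw [blockWeight, blockWeight, hb, valleyWeight, if_neg (not_le.2 h), mul_ite, mul_zero]
    refine if_congr ?_ rfl rfl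
    have hne : c ≠ (valleyBottom Prod.fst (a', c') (w.take i)).2 := by
      have hmem := valleyBottom_mem (Prod.fst : ℕ × Fin r → ℕ) (a', c') (w.take i)
      have hmem' : (valleyBottom Prod.fst (a', c') (w.take i)) ∈ (a', c') :: w :=
        ((List.take_sublist i w).cons_cons (a', c')).subset hmem
      rintro he
      rw [List.map_cons, List.nodup_cons] at hn
      refine hn.1 (List.mem_map.2 ⟨_, hmem', he.symm⟩)
    have hne' : (c : ℕ) ≠ (valleyBottom Prod.fst (a', c') (w.take i)).2 :=
      fun he => hne (Fin.ext he)
    rw [List.map_cons, List.forall_mem_cons, max_le_iff, Fin.le_def]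
    change (((c : ℕ) ≤ _ ∧ _) ∧ _) ↔ _
    constructor
    · rintro ⟨⟨h1, h2⟩, h3⟩
      exact ⟨h2, h3, by omega⟩
    · rintro ⟨h2, h3, h4⟩
      exact ⟨⟨by omega, h2⟩, h3⟩
  · have hle : ¬ (a ≤ a' ∧ c' < c) := fun h' => absurd h'.1 (not_le.2 h)
    rw [tailSum_cons, if_neg hle, add_zero]
    simp [blockWeight, valleyBottom, valleyWeight]

/-- Without a descent after it, the first letter is the bottom of its own block. -/
theorem psiSum_cons_of_le (b a : ℕ) (c : Fin r) (w : List (ℕ × Fin r))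
    (hn : (((a, c) :: w).map Prod.snd).Nodup) (h : ∀ x ∈ w.head?, a ≤ x.1) :
    psiSum q b ((a, c) :: w) = if b ≤ c then tailSum q c a w else 0 := by
  rw [psiSum_eq_sum q _ _ _ hn, tailSum]
  have hi : ∀ i, valleyBottom Prod.fst (a, c) (w.take i) = (a, c) ∧
      blockWeight q b (a, c) (w.take i) = if b ≤ (c : ℕ) then
        (if (a :: (w.take i).map Prod.fst).IsChain (· ≤ ·) ∧ ∀ x ∈ w.take i, x.2 < c then 1 else 0)
        else 0 := by
    intro i
    have hsub : (w.take i).map Prod.snd ⊆ w.map Prod.snd :=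
      ((List.take_sublist i w).map _).subset
    have hh : ∀ x ∈ (w.take i).head?, a ≤ x.1 := by
      intro x hx
      cases i with
      | zero => simp at hx
      | succ i => exact h x (by simpa [List.head?_take] using hx)
    rw [List.map_cons, List.nodup_cons] at hn
    generalize w.take i = l at hsub hh
    have hlt : (∀ d ∈ ((a, c) :: l).map Prod.snd, d ≤ c) ↔ ∀ x ∈ l, x.2 < c := by
      rw [List.map_cons, List.forall_mem_cons, List.forall_mem_map]
      constructor
      · rintro ⟨_, h⟩ x hx
        refine lt_of_le_of_ne (h x hx) ?_
        intro he
        exact hn.1 (hsub (List.mem_map.2 ⟨x, hx, he⟩))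
      · exact fun h => ⟨le_rfl, fun x hx => (h x hx).le⟩
    have hbot : valleyBottom Prod.fst (a, c) l = (a, c) := by
      cases l with
      | nil => rfl
      | cons y l => rw [valleyBottom, if_pos (hh y rfl)]
    refine ⟨hbot, ?_⟩
    rw [blockWeight, hbot]
    simp only [hlt]
    cases l with
    | nil => simp [valleyWeight]
    | cons y l =>
      have hy : a ≤ y.1 := hh y rfl
      rw [valleyWeight, if_pos hy, ← ite_and, ← ite_and]
      refine if_congr ?_ rfl rfl
      rw [List.map_cons, List.isChain_cons_cons, ← List.map_cons, List.isChain_map]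
      tauto
  split_ifs with hb
  · refine Finset.sum_congr rfl fun i _ => ?_
    rw [(hi i).2, (hi i).1, if_pos hb, ite_mul, one_mul, zero_mul]
  · refine Finset.sum_eq_zero fun i _ => ?_
    rw [(hi i).2, if_neg hb, zero_mul]

end BlockProduct

/-! ### Letter-by-letter evaluation -/

section Transfer

variable {R : Type*} [CommRing R] {r : ℕ} (q : R)

/-- The word `w` starts with a letter smaller than `p`. -/
def StartsBelow (p : ℕ) (w : List (ℕ × Fin r)) : Prop := ∃ x ∈ w.head?, x.1 < p

open Classical in
/-- The sum over all ways to continue a factor whose first letter `m` and last letter `p` have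
already been read, either as a completed factor or as an unfinished decreasing run. -/
noncomputable def stateSum (m : Fin r) (p : ℕ) (w : List (ℕ × Fin r)) : R :=
  tailSum q m p w + if StartsBelow p w then -q * psiSum q (m + 1) w else 0

theorem startsBelow_cons (p : ℕ) (x : ℕ × Fin r) (w : List (ℕ × Fin r)) :
    StartsBelow p (x :: w) ↔ x.1 < p := by
  simp [StartsBelow]

theorem not_startsBelow_iff (p : ℕ) (w : List (ℕ × Fin r)) :
    ¬ StartsBelow p w ↔ ∀ x ∈ w.head?, p ≤ x.1 := by
  simp [StartsBelow]

theorem stateSum_nil (m : Fin r) (p : ℕ) : stateSum q m p [] = 1 := by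
  rw [stateSum, tailSum_nil, if_neg (by simp [StartsBelow]), add_zero]

open Classical in
theorem psiSum_cons (b a : ℕ) (c : Fin r) (w : List (ℕ × Fin r))
    (hn : (((a, c) :: w).map Prod.snd).Nodup) :
    psiSum q b ((a, c) :: w) =
      (if StartsBelow a w then -q * psiSum q (max b (c + 1)) w else 0) +
        if b ≤ c then tailSum q c a w else 0 := by
  by_cases h : StartsBelow a w
  · rw [if_pos h]
    cases w with
    | nil => simp [StartsBelow] at h
    | cons x w =>
      rw [startsBelow_cons] at h
      exact psiSum_cons_of_lt q b a c x.1 x.2 w hn h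
  · rw [if_neg h, zero_add]
    exact psiSum_cons_of_le q b a c w hn ((not_startsBelow_iff a w).1 h)

/-- Once a color reaches the bound, `c + 1` supersedes it whether or not the letter is a bottom; so
the state only remembers `c` and `a`. -/
theorem psiSum_cons_of_ge {b a : ℕ} {c : Fin r} {w : List (ℕ × Fin r)}
    (hn : (((a, c) :: w).map Prod.snd).Nodup) (hb : b ≤ c) :
    psiSum q b ((a, c) :: w) = stateSum q c a w := by
  rw [psiSum_cons q b a c w hn, if_pos hb, stateSum, add_comm, max_eq_right (by omega)]

open Classical in
theorem psiSum_cons_of_not_ge {b a : ℕ} {c : Fin r} {w : List (ℕ × Fin r)}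
    (hn : (((a, c) :: w).map Prod.snd).Nodup) (hb : (c : ℕ) < b) :
    psiSum q b ((a, c) :: w) = if StartsBelow a w then -q * psiSum q b w else 0 := by
  rw [psiSum_cons q b a c w hn, if_neg (not_le.2 hb), add_zero, max_eq_left (by omega)]

/-- A descent prevents the current block from growing. Ending it (weight 1) and going on with an
unfinished run (weight -q) leave the same sum. -/
theorem stateSum_of_startsBelow {m : Fin r} {p : ℕ} {w : List (ℕ × Fin r)} (h : StartsBelow p w) :
    stateSum q m p w = (1 - q) * psiSum q (m + 1) w := by
  rw [stateSum, if_pos h]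
  cases w with
  | nil => simp [StartsBelow] at h
  | cons x w =>
    rw [startsBelow_cons] at h
    have hx : ¬ (p ≤ x.1 ∧ x.2 < m) := fun h' => absurd h'.1 (not_le.2 h)
    obtain ⟨a, c⟩ := x
    rw [tailSum_cons, if_neg hx]
    ring

open Classical in
/-- The transfer rule for `stateSum`. -/
theorem stateSum_cons {m : Fin r} {p a : ℕ} {c : Fin r} {w : List (ℕ × Fin r)}
    (hn : (((a, c) :: w).map Prod.snd).Nodup) (hm : c ≠ m) :
    stateSum q m p ((a, c) :: w) =
      (if a < p then (if m < c then 1 - q else if StartsBelow a w then -q else 0) else 1) *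
        stateSum q (max m c) a w := by
  have hm' : (c : ℕ) ≠ m := fun h => hm (Fin.ext h)
  by_cases hap : a < p
  · rw [stateSum_of_startsBelow q ((startsBelow_cons _ _ _).2 hap), if_pos hap]
    by_cases hmc : m < c
    · rw [if_pos hmc, max_eq_right hmc.le, psiSum_cons_of_ge q hn]
      exact hmc
    -- After a descent, a letter of color below `m` can be neither a bottom nor an increasing step,
    -- so another descent must follow. The factor 1-q is then reabsorbed into the next `stateSum`,
    -- leaving -q.
    · rw [if_neg hmc, max_eq_left (not_lt.1 hmc), psiSum_cons_of_not_ge q hn]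
      · split_ifs with h
        · rw [stateSum_of_startsBelow q h]
          ring
        · ring
      · exact Nat.lt_succ_of_le (not_lt.1 hmc)
  · rw [if_neg hap, one_mul, stateSum, if_neg (by rwa [startsBelow_cons]), add_zero, tailSum_cons]
    by_cases hmc : m < c
    · have : ¬ (p ≤ a ∧ c < m) := fun h => absurd h.2 hmc.asymm
      rw [if_neg this, add_zero, max_eq_right hmc.le, psiSum_cons_of_ge q hn]
      exact hmc
    · have hcm : c < m := lt_of_le_of_ne (not_lt.1 hmc) hm
      -- The letter either extends the block or opens a decreasing run: exactly the two terms of the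
      -- new `stateSum`.
      rw [if_pos ⟨not_lt.1 hap, hcm⟩, max_eq_left hcm.le, psiSum_cons_of_not_ge q hn, stateSum,
        add_comm]
      exact Nat.lt_succ_of_lt hcm

/-- The word of first components of `W` has a descent after its first `d` letters. -/
def DescentAt (W : List (ℕ × Fin r)) (d : ℕ) : Prop :=
  ∃ y ∈ W[d - 1]?, ∃ x ∈ W[d]?, x.1 < y.1

/-- The letter of `W` following the first `d` ones has a larger color than all of them. -/
def RecordAt (W : List (ℕ × Fin r)) (d : ℕ) : Prop :=
  ∀ y ∈ W[d]?, ∀ x ∈ W.take d, x.2 < y.2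

open Classical in
/-- The local factor of the coefficient of a colored word. -/
noncomputable def localFactor (W : List (ℕ × Fin r)) (d : ℕ) : R :=
  if DescentAt W d then (if RecordAt W d then 1 - q else if DescentAt W (d + 1) then -q else 0)
  else 1

theorem descentAt_append (P : List (ℕ × Fin r)) (y : ℕ × Fin r) (w : List (ℕ × Fin r)) :
    DescentAt (P ++ y :: w) (P.length + 1) ↔ StartsBelow y.1 w := by
  have h : (P ++ y :: w)[P.length + 1]? = w.head? := by
    rw [List.getElem?_append_right (by omega)]
    simp [List.head?_eq_getElem?]
  rw [DescentAt, h]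
  simp [StartsBelow]

theorem stateSum_eq_prod (P : List (ℕ × Fin r)) (y : ℕ × Fin r) (w : List (ℕ × Fin r)) (m : Fin r)
    (hn : ((P ++ y :: w).map Prod.snd).Nodup) (hm : m ∈ (P ++ [y]).map Prod.snd)
    (hmax : ∀ x ∈ P ++ [y], x.2 ≤ m) :
    stateSum q m y.1 w =
      ∏ d ∈ Finset.Ico (P.length + 1) (P ++ y :: w).length, localFactor q (P ++ y :: w) d := by
  classical
  induction w generalizing P y m with
  | nil => simp [stateSum_nil]
  | cons x w ih =>
    have e : P ++ y :: x :: w = (P ++ [y]) ++ x :: w := by simp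
    have hn' := hn
    rw [e, List.map_append, List.nodup_append] at hn'
    have hx : x.2 ≠ m := fun h => hn'.2.2 m hm x.2 (by simp) h.symm
    have hlt : P.length + 1 < (P ++ y :: x :: w).length := by simp
    rw [Finset.prod_eq_prod_Ico_succ_bot hlt]
    have ih' := ih (P ++ [y]) x (max m x.2) (e ▸ hn) (by
        rcases max_choice m x.2 with h | h <;> rw [h]
        · rw [List.map_append]
          exact List.mem_append_left _ hm
        · simp) (by
        intro z hz
        rcases List.mem_append.1 hz with hz | hz
        · exact (hmax z hz).trans (le_max_left _ _)
        · rw [List.mem_singleton.1 hz]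
          exact le_max_right _ _)
    rw [← e, List.length_append, List.length_singleton] at ih'
    rw [← ih', stateSum_cons q hn'.2.1 hx]
    congr 1
    have h1 : DescentAt (P ++ y :: x :: w) (P.length + 1) ↔ x.1 < y.1 := by
      rw [descentAt_append, startsBelow_cons]
    have h2 : DescentAt (P ++ y :: x :: w) (P.length + 1 + 1) ↔ StartsBelow x.1 w := by
      have := descentAt_append (P ++ [y]) x w
      rwa [← e, List.length_append] at this
    have h3 : RecordAt (P ++ y :: x :: w) (P.length + 1) ↔ m < x.2 := by
      have ht : ((P ++ [y]) ++ x :: w).take (P.length + 1) = P ++ [y] :=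
        List.take_left' (by simp)
      have hg : ((P ++ [y]) ++ x :: w)[P.length + 1]? = some x := by
        rw [List.getElem?_append_right (by simp)]
        simp
      rw [e, RecordAt, ht, hg]
      constructor
      · intro h
        obtain ⟨z, hz, rfl⟩ := List.mem_map.1 hm
        exact h x rfl z hz
      · intro h z hz u hu
        obtain rfl : x = z := by simpa using hz
        exact (hmax u hu).trans_lt h
    rw [localFactor]
    exact (if_congr h1 (if_congr h3 rfl (if_congr h2 rfl rfl)) rfl).symm

theorem psiSum_eq_prod (W : List (ℕ × Fin r)) (hn : (W.map Prod.snd).Nodup) :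
    psiSum q 0 W = ∏ d ∈ Finset.Ico 1 W.length, localFactor q W d := by
  cases W with
  | nil => simp [psiSum_nil]
  | cons x w =>
    rw [psiSum_cons_of_ge q hn (Nat.zero_le _)]
    exact stateSum_eq_prod q [] x w x.2 hn (by simp) (by simp)

end Transfer

/-! ### The coefficient as a product of local factors -/

section Coefficient

/-- The set in the condition consists of the elements of `E` whose successor is not in `E`. One of
them outside `F` gives a factor 0; otherwise each element of `E` gives 1-q or -q according to
membership in `F`. Positivity of `E` makes d ↦ d-1 invertible on it. -/
theorem ite_pow_mul_pow_eq_prod {R : Type*} [CommRing R] (q : R) {n : ℕ} {E F : Finset ℕ}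
    (hE : E ⊆ Finset.Ico 1 n) :
    (if E \ E.image (fun d => d - 1) ⊆ F then
      (-q) ^ (E \ F).card * (1 - q) ^ (E ∩ F).card else 0) =
      ∏ d ∈ Finset.Ico 1 n,
        if d ∈ E then (if d ∈ F then 1 - q else if d + 1 ∈ E then -q else 0) else 1 := by
  rw [← Finset.prod_filter, Finset.filter_mem_eq_inter, Finset.inter_eq_right.2 hE]
  have hpred : ∀ d, d ∈ E.image (fun d => d - 1) ↔ d + 1 ∈ E := by
    intro d
    rw [Finset.mem_image]
    constructor
    · rintro ⟨e, he, rfl⟩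
      have := (Finset.mem_Ico.1 (hE he)).1
      rwa [Nat.sub_add_cancel this]
    · exact fun h => ⟨d + 1, h, rfl⟩
  split_ifs with h
  · have hcongr : ∀ d ∈ E, (if d ∈ F then 1 - q else if d + 1 ∈ E then -q else 0) =
        if d ∈ F then 1 - q else -q := by
      intro d hd
      split_ifs with h1 h2
      · rfl
      · rfl
      · exact absurd (h (Finset.mem_sdiff.2 ⟨hd, fun h' => h2 ((hpred d).1 h')⟩)) h1
    rw [Finset.prod_congr rfl hcongr, Finset.prod_ite, Finset.prod_const, Finset.prod_const,
      Finset.filter_mem_eq_inter, Finset.filter_notMem_eq_sdiff, mul_comm]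
  · obtain ⟨d, hd, hdF⟩ := Finset.not_subset.1 h
    rw [Finset.mem_sdiff, hpred] at hd
    exact (Finset.prod_eq_zero hd.1 (by rw [if_neg hdF, if_neg hd.2])).symm

end Coefficient

/-! ### Descent sets of the two compositions -/

section DescentSets

theorem mem_Des_sizesComposition {α : Type*} {n : ℕ} {L : List (List α)} (hL : [] ∉ L)
    (hn : L.flatten.length = n) (d : ℕ) : d ∈ Des (sizesComposition L hL hn) ↔
      ∃ L₁ L₂, L = L₁ ++ L₂ ∧ L₁ ≠ [] ∧ L₂ ≠ [] ∧ d = L₁.flatten.length := by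
  have hs : ∀ k, (sizesComposition L hL hn).sizeUpTo k = (L.take k).flatten.length := by
    intro k
    rw [List.length_flatten, List.map_take]
    rfl
  have hl : (sizesComposition L hL hn).length = L.length := List.length_map _
  simp only [Des, Finset.mem_image, Finset.mem_Ico, hs, hl]
  constructor
  · rintro ⟨k, ⟨hk, hk'⟩, rfl⟩
    refine ⟨L.take k, L.drop k, (List.take_append_drop k L).symm, ?_, ?_, rfl⟩
    · rw [Ne, ← List.length_eq_zero_iff, List.length_take]
      omega
    · rw [Ne, ← List.length_eq_zero_iff, List.length_drop]
      omega
  · rintro ⟨L₁, L₂, rfl, h1, h2, rfl⟩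
    have h1' := List.length_pos_iff.2 h1
    have h2' := List.length_pos_iff.2 h2
    refine ⟨L₁.length, ⟨h1', by rw [List.length_append]; omega⟩, ?_⟩
    rw [List.take_left' rfl]

theorem exists_split_flatten {α : Type*} (L : List (List α)) (d : ℕ) (h : d < L.flatten.length) :
    ∃ L₁ u₁ u₂ L₂, L = L₁ ++ (u₁ ++ u₂) :: L₂ ∧ u₂ ≠ [] ∧
      d = L₁.flatten.length + u₁.length := by
  induction L generalizing d with
  | nil => simp at h
  | cons u L ih =>
    by_cases hd : d < u.length
    · refine ⟨[], u.take d, u.drop d, L, by simp, ?_, ?_⟩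
      · rw [Ne, ← List.length_eq_zero_iff, List.length_drop]
        omega
      · simp [hd.le]
    · rw [List.flatten_cons, List.length_append] at h
      obtain ⟨L₁, u₁, u₂, L₂, rfl, hu, he⟩ := ih (d - u.length) (by omega)
      refine ⟨u :: L₁, u₁, u₂, L₂, rfl, hu, ?_⟩
      rw [List.flatten_cons, List.length_append]
      omega

/-- If `B` holds at the boundaries between the factors in `L` and fails inside the factors, then
it describes the descent set of the composition of the sizes. -/
theorem mem_Des_sizesComposition_iff {α : Type*} {n : ℕ} {L : List (List α)} {l : List α}
    (hl : L.flatten = l) (hL : [] ∉ L) (hn : L.flatten.length = n) (B : List α → List α → Prop)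
    (hB : ∀ L₁ L₂, L = L₁ ++ L₂ → L₁ ≠ [] → L₂ ≠ [] → B L₁.flatten L₂.flatten)
    (hB' : ∀ L₁ u₁ u₂ L₂, L = L₁ ++ (u₁ ++ u₂) :: L₂ → u₁ ≠ [] → u₂ ≠ [] →
      ¬ B (L₁.flatten ++ u₁) (u₂ ++ L₂.flatten)) (d : ℕ) :
    d ∈ Des (sizesComposition L hL hn) ↔
      (0 < d ∧ d < n) ∧ B (l.take d) (l.drop d) := by
  subst hl
  rw [mem_Des_sizesComposition]
  have hpos : ∀ L' : List (List α), L' ⊆ L → L' ≠ [] → 0 < L'.flatten.length := by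
    intro L' hsub hne
    obtain ⟨u, L', rfl⟩ := List.exists_cons_of_ne_nil hne
    rw [List.flatten_cons, List.length_append]
    have : u ≠ [] := fun h => hL (h ▸ hsub (by simp))
    have := List.length_pos_iff.2 this
    omega
  constructor
  · rintro ⟨L₁, L₂, rfl, h1, h2, rfl⟩
    have p1 := hpos L₁ (by simp) h1
    have p2 := hpos L₂ (by simp) h2
    rw [List.flatten_append, List.length_append] at hn
    refine ⟨⟨p1, by omega⟩, ?_⟩
    rw [List.flatten_append, List.take_left' rfl, List.drop_left' rfl]
    exact hB L₁ L₂ rfl h1 h2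
  · rintro ⟨⟨h1, h2⟩, h3⟩
    obtain ⟨L₁, u₁, u₂, L₂, rfl, hu, rfl⟩ := exists_split_flatten L d (hn ▸ h2)
    by_cases hu1 : u₁ = []
    · subst hu1
      refine ⟨L₁, u₂ :: L₂, rfl, ?_, by simp, by simp⟩
      rintro rfl
      simp at h1
    · exfalso
      refine hB' L₁ u₁ u₂ L₂ rfl hu1 hu ?_
      have e : (L₁ ++ (u₁ ++ u₂) :: L₂).flatten =
          (L₁.flatten ++ u₁) ++ (u₂ ++ L₂.flatten) := by simp
      rw [e, List.take_left' (by simp), List.drop_left' (by simp)] at h3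
      exact h3

theorem mem_Des_descentComposition {n : ℕ} (τ : Equiv.Perm (Fin n)) (d : ℕ) :
    d ∈ Des (descentComposition τ) ↔ (0 < d ∧ d < n) ∧
      ∃ y ∈ ((permWord τ).take d).getLast?, ∃ x ∈ ((permWord τ).drop d).head?, ¬ y < x := by
  refine mem_Des_sizesComposition_iff (n := n) (L := (permWord τ).splitBy fun a b => decide (a < b))
    (List.flatten_splitBy _ _) (List.nil_notMem_splitBy _ _)
    (by rw [List.flatten_splitBy]; simp [permWord])
    (fun s t => ∃ y ∈ s.getLast?, ∃ x ∈ t.head?, ¬ y < x) ?_ ?_ d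
  · intro L₁ L₂ hL h1 h2
    have hc := List.isChain_getLast_head_splitBy (fun a b : ℕ => decide (a < b)) (permWord τ)
    rw [hL, List.isChain_append] at hc
    obtain ⟨L₁, u, rfl⟩ := (List.eq_nil_or_concat L₁).resolve_left h1
    obtain ⟨v, L₂, rfl⟩ := List.exists_cons_of_ne_nil h2
    obtain ⟨hu, hv, h⟩ := hc.2.2 u (by simp) v (by simp)
    refine ⟨u.getLast hu, ?_, v.head hv, ?_, by simpa using h⟩
    · simp [List.getLast?_append, List.getLast?_eq_some_getLast hu]
    · simp [List.head?_append, List.head?_eq_some_head hv]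
  · rintro L₁ u₁ u₂ L₂ hL h1 h2 ⟨y, hy, x, hx, hyx⟩
    have hc := List.isChain_of_mem_splitBy (r := fun a b : ℕ => decide (a < b))
      (l := permWord τ) (m := u₁ ++ u₂) (by rw [hL]; simp)
    rw [List.isChain_append] at hc
    have hy' : y ∈ u₁.getLast? := by
      rw [List.getLast?_eq_some_getLast h1]
      rw [List.getLast?_append, List.getLast?_eq_some_getLast h1] at hy
      exact hy
    have hx' : x ∈ u₂.head? := by
      rw [List.head?_eq_some_head h2]
      rw [List.head?_append, List.head?_eq_some_head h2] at hx
      exact hx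
    exact hyx (by simpa using hc.2.2 y hy' x hx')

/-- Every factor lies weakly below its first letter, and first letters increase weakly. Hence
factors start exactly at the left-to-right maxima. -/
theorem le_of_mem_append_factors {α : Type*} [LinearOrder α] {L₁ : List (List α)} {u : List α}
    {a : α} (hdom : ∀ v ∈ L₁, InitiallyDominated v)
    (hch : (L₁ ++ [u]).IsChain fun u v => ∀ a ∈ u.head?, ∀ b ∈ v.head?, a ≤ b)
    (ha : a ∈ u.head?) : ∀ x ∈ L₁.flatten, x ≤ a := by
  induction L₁ using List.reverseRecOn generalizing u a with
  | nil => simp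
  | append_singleton L v ih =>
    intro x hx
    rw [List.isChain_append] at hch
    have hv := hdom v (by simp)
    cases v with
    | nil => exact hv.elim
    | cons c t =>
      have hca : c ≤ a := hch.2.2 (c :: t) (by simp) u (by simp) c rfl a ha
      rw [List.flatten_append, List.mem_append] at hx
      rcases hx with hx | hx
      · exact (ih (fun w hw => hdom w (List.mem_append_left _ hw)) hch.1 rfl x hx).trans hca
      · simp only [List.flatten_cons, List.flatten_nil, List.append_nil, List.mem_cons] at hx
        rcases hx with rfl | hx
        · exact hca
        · exact (hv x hx).le.trans hca

theorem nodup_permColorWord {n : ℕ} (σ : Equiv.Perm (Fin n)) : (permColorWord σ).Nodup :=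
  List.nodup_ofFn.2 σ.injective

theorem mem_Des_saillanceComposition {n : ℕ} (σ : Equiv.Perm (Fin n)) (d : ℕ) :
    d ∈ Des (saillanceComposition σ) ↔ (0 < d ∧ d < n) ∧
      ∀ y ∈ ((permColorWord σ).drop d).head?, ∀ x ∈ (permColorWord σ).take d, x < y := by
  obtain ⟨hfl, hdom, hch⟩ := (increasingFactorization_eq_iff (permColorWord σ) _).1 rfl
  have hnd := nodup_permColorWord σ
  refine mem_Des_sizesComposition_iff (n := n) (L := increasingFactorization (permColorWord σ))
    hfl (fun h => (hdom [] h).elim) (by rw [hfl]; simp [permColorWord])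
    (fun s t => ∀ y ∈ t.head?, ∀ x ∈ s, x < y) ?_ ?_ d
  · intro L₁ L₂ hL h1 h2 y hy x hx
    rw [hL] at hfl hdom hch
    obtain ⟨v, L₂, rfl⟩ := List.exists_cons_of_ne_nil h2
    have hv : v ≠ [] := by
      rintro rfl
      exact (hdom [] (by simp)).elim
    have hy' : y ∈ v.head? := by
      rw [List.head?_eq_some_head hv]
      rw [List.flatten_cons, List.head?_append, List.head?_eq_some_head hv] at hy
      exact hy
    refine lt_of_le_of_ne (le_of_mem_append_factors (L₁ := L₁) (u := v)
      (fun w hw => hdom w (List.mem_append_left _ hw)) ?_ hy' x hx) ?_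
    · rw [List.append_cons] at hch
      exact (List.isChain_append.1 hch).1
    · rw [← hfl, List.flatten_append, List.nodup_append] at hnd
      exact hnd.2.2 x hx y (List.mem_of_mem_head? hy)
  · intro L₁ u₁ u₂ L₂ hL h1 h2 h
    have hu := hdom (u₁ ++ u₂) (by rw [hL]; simp)
    obtain ⟨a, t, rfl⟩ := List.exists_cons_of_ne_nil h1
    obtain ⟨b, s, rfl⟩ := List.exists_cons_of_ne_nil h2
    exact absurd (h b rfl a (by simp)) (hu b (by simp)).asymm

end DescentSets

/-! ### Permutations as words -/

section Words

theorem exists_permColorWord {n : ℕ} {u : List (Fin n)} (hu : u.Nodup) (hl : u.length = n) :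
    ∃ σ : Equiv.Perm (Fin n), permColorWord σ = u := by
  have hinj : Function.Injective fun i : Fin n => u.get (i.cast hl.symm) := by
    intro i j h
    simpa using hu.injective_get h
  refine ⟨Equiv.ofBijective _ (Finite.injective_iff_bijective.1 hinj), ?_⟩
  refine List.ext_getElem (by simp [permColorWord, hl]) fun i h1 h2 => ?_
  simp [permColorWord]

theorem exists_permWord {n : ℕ} {l : List ℕ} (hl : l.Perm (List.range' 1 n)) :
    ∃ τ : Equiv.Perm (Fin n), permWord τ = l := by
  have hlen : l.length = n := by rw [hl.length_eq, List.length_range']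
  have hmem : ∀ i (h : i < l.length), 1 ≤ l[i] ∧ l[i] < 1 + n := fun i h =>
    List.mem_range'_1.1 (hl.mem_iff.1 (List.getElem_mem h))
  obtain ⟨τ, hτ⟩ := exists_permColorWord (n := n)
    (u := List.ofFn fun i : Fin n => ⟨l[(i : ℕ)]'(by omega) - 1, by
      have := hmem i (by omega)
      omega⟩) (by
    rw [List.nodup_ofFn]
    intro i j h
    have hi := hmem i (by omega)
    have hj := hmem j (by omega)
    have h' : l[(i : ℕ)]'(by omega) = l[(j : ℕ)]'(by omega) := by
      have := congrArg Fin.val h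
      dsimp only at this
      omega
    exact Fin.ext ((hl.nodup_iff.2 List.nodup_range').getElem_inj_iff.1 h')) (by simp)
  refine ⟨τ, ?_⟩
  have h := List.ofFn_injective hτ
  refine List.ext_getElem (by simp [permWord, hlen]) fun i h1 h2 => ?_
  have hi := hmem i h2
  have := congrFun h ⟨i, by omega⟩
  simp only [permWord, List.getElem_ofFn, this]
  omega

theorem permColorWord_injective {n : ℕ} :
    Function.Injective (permColorWord : Equiv.Perm (Fin n) → List (Fin n)) := by
  intro σ σ' h
  exact Equiv.ext (congrFun (List.ofFn_injective h))

theorem permWord_injective {n : ℕ} :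
    Function.Injective (permWord : Equiv.Perm (Fin n) → List ℕ) := by
  intro σ σ' h
  refine Equiv.ext fun i => Fin.ext ?_
  have := congrFun (List.ofFn_injective h) i
  omega

theorem permColorWord_perm {n : ℕ} (σ σ' : Equiv.Perm (Fin n)) :
    (permColorWord σ).Perm (permColorWord σ') := by
  refine (List.perm_ext_iff_of_nodup (nodup_permColorWord σ) (nodup_permColorWord σ')).2 fun a => ?_
  have h : ∀ σ : Equiv.Perm (Fin n), a ∈ permColorWord σ := fun σ =>
    (List.mem_ofFn' _ _).2 ⟨σ.symm a, σ.apply_symm_apply a⟩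
  exact ⟨fun _ => h _, fun _ => h _⟩

end Words

/-! ### Comparison of coefficients -/

section Main

variable {R : Type*} [CommRing R]

/-- The coefficient of a word, as an additive map. -/
def coeffHom {X : Type*} (w : List X) : WordSeries R X →+ R where
  toFun f := f w
  map_zero' := rfl
  map_add' _ _ := rfl

theorem coe_sum_apply {r : ℕ} {ι : Type*} (s : Finset ι) (f : ι → FQSym R r)
    (w : List (ℕ × Fin r)) : (∑ i ∈ s, f i).1 w = ∑ i ∈ s, (f i).1 w :=
  map_sum ((coeffHom w).comp (FQSym R r).val.toAddMonoidHom) f s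

/-- Each pair of permutations belongs to exactly one colored ribbon, so the sums over compositions
collapse. -/
theorem sum_smul_coloredRibbon {n : ℕ} (c : Composition n → Composition n → R) :
    ∑ I : Composition n, ∑ J : Composition n, c I J • coloredRibbon R I J =
      ∑ σ : Equiv.Perm (Fin n), ∑ τ : Equiv.Perm (Fin n),
        c (descentComposition τ) (saillanceComposition σ) •
          biwordG R (permWord τ) (permColorWord σ) := by
  have h1 : ∀ I J : Composition n, c I J • coloredRibbon R I J =
      ∑ σ : Equiv.Perm (Fin n), if saillanceComposition σ = J then
        ∑ τ : Equiv.Perm (Fin n), if descentComposition τ = I then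
          c I J • biwordG R (permWord τ) (permColorWord σ) else 0 else 0 := by
    intro I J
    rw [coloredRibbon, Finset.sum_filter, Finset.smul_sum]
    refine Finset.sum_congr rfl fun σ _ => ?_
    rw [smul_ite, smul_zero, ribbonWord, Finset.sum_filter, Finset.smul_sum]
    simp only [smul_ite, smul_zero]
  have h2 : ∀ I : Composition n, ∑ J : Composition n, c I J • coloredRibbon R I J =
      ∑ σ : Equiv.Perm (Fin n), ∑ τ : Equiv.Perm (Fin n), if descentComposition τ = I then
          c I (saillanceComposition σ) • biwordG R (permWord τ) (permColorWord σ) else 0 := by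
    intro I
    rw [Finset.sum_congr rfl fun J _ => h1 I J, Finset.sum_comm]
    refine Finset.sum_congr rfl fun σ _ => ?_
    rw [Finset.sum_ite_eq, if_pos (Finset.mem_univ _)]
  rw [Finset.sum_congr rfl fun I _ => h2 I, Finset.sum_comm]
  refine Finset.sum_congr rfl fun σ _ => ?_
  rw [Finset.sum_comm]
  refine Finset.sum_congr rfl fun τ _ => ?_
  rw [Finset.sum_ite_eq, if_pos (Finset.mem_univ _)]

theorem sum_PsiPerm_apply (q : R) {n : ℕ} (σ : Equiv.Perm (Fin n)) (w : List (ℕ × Fin n))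
    (hw : w.map Prod.snd = permColorWord σ) :
    ∑ σ' : Equiv.Perm (Fin n), psiSeries q (permColorWord σ') w = psiSum q 0 w := by
  classical
  refine Finset.sum_of_injOn permColorWord permColorWord_injective.injOn ?_ ?_ fun _ _ => rfl
  · intro σ' _
    simp only [Finset.coe_filter, Set.mem_ofPred_eq, List.mem_toFinset, List.mem_permutations]
    exact ⟨hw ▸ permColorWord_perm σ' σ, fun _ _ => Nat.zero_le _⟩
  · intro u hu hnot
    rw [Finset.mem_filter, List.mem_toFinset, List.mem_permutations, hw] at hu
    obtain ⟨σ', rfl⟩ := exists_permColorWord (hu.1.nodup_iff.2 (nodup_permColorWord σ))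
      (by rw [hu.1.length_eq]; simp [permColorWord])
    exact absurd ⟨σ', by simp, rfl⟩ hnot

/-- No range is imposed on `d`: the local factor also tests `d + 1`, which may equal `n`, where both
sides are false. -/
theorem descentAt_iff {n : ℕ} {w : List (ℕ × Fin n)} {τ : Equiv.Perm (Fin n)} {d : ℕ}
    (hl : w.length = n) (hτ : permWord τ = standardization (w.map Prod.fst)) :
    d ∈ Des (descentComposition τ) ↔ DescentAt w d := by
  rw [mem_Des_descentComposition, hτ]
  by_cases hd : 0 < d ∧ d < n
  · have h := standardization_le_iff (w.map Prod.fst) (i := d - 1) (j := d) (by omega)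
      (by simp; omega)
    have hn : (standardization (w.map Prod.fst)).Nodup :=
      (standardization_perm _).nodup_iff.2 List.nodup_range'
    have hls : (standardization (w.map Prod.fst)).length = n := by
      simp [length_standardization, hl]
    have hne : (standardization (w.map Prod.fst))[d - 1]'(by omega) ≠
        (standardization (w.map Prod.fst))[d]'(by omega) := by
      rw [Ne, hn.getElem_inj_iff]
      omega
    have e1 : ((standardization (w.map Prod.fst)).take d).getLast? =
        some ((standardization (w.map Prod.fst))[d - 1]'(by omega)) := by
      rw [List.getLast?_take, if_neg (by omega), List.getElem?_eq_getElem (by omega)]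
      rfl
    have e2 : ((standardization (w.map Prod.fst)).drop d).head? =
        some ((standardization (w.map Prod.fst))[d]'(by omega)) := by
      rw [List.head?_drop, List.getElem?_eq_getElem (by omega)]
    rw [e1, e2, DescentAt, List.getElem?_eq_getElem (by omega), List.getElem?_eq_getElem (by omega)]
    simp only [List.getElem_map] at h
    simp only [Option.mem_def, Option.some.injEq, exists_eq_left']
    omega
  · refine iff_of_false (fun h => hd h.1) ?_
    rintro ⟨y, hy, x, hx, hxy⟩
    obtain ⟨hdl, -⟩ := List.getElem?_eq_some_iff.1 hx
    have : d = 0 := by omega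
    subst this
    -- At `d = 0` truncated subtraction compares the first letter with itself.
    obtain rfl : y = x := Option.some.inj (hy.symm.trans hx)
    exact lt_irrefl _ hxy

/-- The range is needed here, since `RecordAt` holds vacuously at 0 and beyond the end of the word.
-/
theorem recordAt_iff {n : ℕ} {w : List (ℕ × Fin n)} {σ : Equiv.Perm (Fin n)} {d : ℕ}
    (hd : 0 < d ∧ d < n) (hσ : permColorWord σ = w.map Prod.snd) :
    d ∈ Des (saillanceComposition σ) ↔ RecordAt w d := by
  rw [mem_Des_saillanceComposition, and_iff_right hd, hσ, RecordAt, List.head?_drop,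
    List.getElem?_map, ← List.map_take]
  simp only [List.forall_mem_map, Option.mem_def, Option.map_eq_some_iff, forall_exists_index,
    and_imp, forall_apply_eq_imp_iff₂]

theorem ribbonCoeff_eq_prod (q : R) {n : ℕ} {w : List (ℕ × Fin n)} {σ τ : Equiv.Perm (Fin n)}
    (hσ : permColorWord σ = w.map Prod.snd)
    (hτ : permWord τ = standardization (w.map Prod.fst)) :
    ribbonCoeff q (descentComposition τ) (saillanceComposition σ) =
      ∏ d ∈ Finset.Ico 1 w.length, localFactor q w d := by
  classical
  have hl : w.length = n := by
    have := congrArg List.length hσ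
    simpa [permColorWord] using this.symm
  have hE : Des (descentComposition τ) ⊆ Finset.Ico 1 n := by
    intro d hd
    exact Finset.mem_Ico.2 ((mem_Des_descentComposition τ d).1 hd).1
  rw [ribbonCoeff, DesPred, ite_pow_mul_pow_eq_prod q hE, hl]
  refine Finset.prod_congr rfl fun d hd => ?_
  exact if_congr (descentAt_iff hl hτ) (if_congr (recordAt_iff (Finset.mem_Ico.1 hd) hσ) rfl
    (if_congr (descentAt_iff hl hτ) rfl rfl)) rfl

end Main

theorem mainTheorem3 {R : Type*} [CommRing R] (q : R) (n : ℕ) :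
    ∑ σ : Equiv.Perm (Fin n), PsiPerm q σ =
      ∑ I : Composition n, ∑ J : Composition n, ribbonCoeff q I J • coloredRibbon R I J := by
  rw [sum_smul_coloredRibbon]
  refine Subtype.ext (funext fun w => ?_)
  have hR : ∀ σ τ : Equiv.Perm (Fin n),
      (ribbonCoeff q (descentComposition τ) (saillanceComposition σ) •
        biwordG R (permWord τ) (permColorWord σ)).1 w =
      ribbonCoeff q (descentComposition τ) (saillanceComposition σ) *
        if standardization (w.map Prod.fst) = permWord τ ∧ w.map Prod.snd = permColorWord σ
          then 1 else 0 := fun _ _ => rfl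
  simp only [coe_sum_apply, hR, coe_PsiPerm]
  by_cases h : ∃ σ : Equiv.Perm (Fin n), w.map Prod.snd = permColorWord σ
  · obtain ⟨σ, hσ⟩ := h
    have hl : w.length = n := by
      have := congrArg List.length hσ
      simpa [permColorWord] using this
    have hst := standardization_perm (w.map Prod.fst)
    rw [List.length_map, hl] at hst
    obtain ⟨τ, hτ⟩ := exists_permWord hst
    rw [sum_PsiPerm_apply q σ w hσ, psiSum_eq_prod q w (hσ ▸ nodup_permColorWord σ),
      ← ribbonCoeff_eq_prod q hσ.symm hτ, Finset.sum_eq_single σ, Finset.sum_eq_single τ]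
    · rw [if_pos ⟨hτ.symm, hσ⟩, mul_one]
    · intro τ' _ hne
      rw [if_neg, mul_zero]
      exact fun h => hne (permWord_injective (h.1.symm.trans hτ.symm))
    · simp
    · intro σ' _ hne
      refine Finset.sum_eq_zero fun τ' _ => ?_
      rw [if_neg, mul_zero]
      exact fun h => hne (permColorWord_injective (h.2.symm.trans hσ))
    · simp
  -- When the colors do not form a permutation, the support of the products of Ψ kills the left side
  -- and the support of G the right.
  · rw [Finset.sum_eq_zero, Finset.sum_eq_zero]
    · intro σ _
      refine Finset.sum_eq_zero fun τ _ => ?_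
      rw [if_neg (fun h' => h ⟨σ, h'.2⟩), mul_zero]
    · intro σ _
      by_contra hne
      have hp := perm_of_psiSeries_ne_zero q hne
      obtain ⟨σ', hσ'⟩ := exists_permColorWord (hp.nodup_iff.1 (nodup_permColorWord σ))
        (by rw [← hp.length_eq]; simp [permColorWord])
      exact h ⟨σ', hσ'.symm⟩
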